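/- Let $d_{\mathrm{in}},d_{\mathrm{out}},\chi\ge 0$ and $D\ge 1$ be integers, and let $\mathcal V$ be a tensor consisting of $D\times D$ complex matrices $\mathcal V^{o,p,i}$, with $o\le d_{\mathrm{out}}$ (physical output), $p\le\chi$ (purification output), $i\le d_{\mathrm{in}}$ (physical input). For $N\ge1$ let $V_N:(\mathbb C^{d_{\mathrm{in}}})^{\otimes N}\to(\mathbb C^{d_{\mathrm{out}}}\otimes\mathbb C^{\chi})^{\otimes N}$ be the operator with entries $$\langle (o_1p_1)\dots(o_Np_N)|V_N|i_1\dots i_N\rangle=\operatorname{Tr}\bigl[\mathcal V^{o_1,p_1,i_1}\cdots\mathcal V^{o_N,p_N,i_N}\bigr].$$ Assume that $\mathcal V$ generates a homogeneous matrix product isometry (hMPI), i.e. $V_N^\dagger V_N=\mathbb 1$ for all $N\ge 1$. For $q\ge1$ let $\mathcal V_q$ be the blocked tensor, whose matrices are the products of $q$ consecutive matrices of $\mathcal V$; its physical input, physical output and purification dimensions are $d_{\mathrm{in}}^q$, $d_{\mathrm{out}}^q$ and $\chi^q$. Then there is an integer $q$ with $1\le q\le D^4$ such that the following hold. 1. (Depth-two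 circuit.) There are integers $\ell,r\ge 0$ and isometries $u:(\mathbb C^{d_{\mathrm{in}}^q})^{\otimes2}\to\mathbb C^{\ell}\otimes\mathbb C^{r}$ and $v:\mathbb C^{r}\otimes\mathbb C^{\ell}\to(\mathbb C^{d_{\mathrm{out}}^q}\otimes\mathbb C^{\chi^q})^{\otimes 2}$, that is, $u^\dagger u=\mathbb 1$ and $v^\dagger v=\mathbb 1$, so that $$(d_{\mathrm{in}}^{q})^2\le r\ell\le (d_{\mathrm{out}}^{q})^2(\chi^{q})^2,$$ such that for every $n\ge 1$ the operator generated by $\mathcal V_q$ on a periodic chain of $2n$ blocked sites $0,1,\dots,2n-1$ equals the brick-wall circuit consisting of a first layer of gates $u$ on the pairs $(2k,2k+1)$, where the output $\mathbb C^\ell$ is left at site $2k$ and the output $\mathbb C^r$ at site $2k+1$, followed by a second layer of gates $v$ on the pairs $(2k+1,2k+2)$ (sites modulo $2n$), acting on the wire $\mathbb C^r$ at $2k+1$ and the wire $\mathbb C^\ell$ at $2k+2$. 2. (Strictly short-range correlations.) Say that a state $\rho$ of a periodic chain has correlation range at most $\xi$ if $\rho_{A\cup B}=\rho_A\otimes\rho_B$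 for all sets of sites $A,B$ whose ring distance exceeds $\xi$ (product states have range $0$). On a periodic chain of any number of blocked sites, if the input density matrix $\sigma$ has correlation range at most $\xi$, then both the output $V\sigma V^\dagger$ of the operator $V$ generated by $\mathcal V_q$ and the output $\operatorname{Tr}_{\mathrm{pur}}[V\sigma V^\dagger]$ of the associated homogeneous locally purified (hLP) channel have correlation range at most $\xi+4$, distances being measured in blocked sites. Without blocking, for every $N\ge1$ and every density matrix $\sigma$ of $N$ sites with correlation range at most $\xi$, both $V_N\sigma V_N^\dagger$ and $\operatorname{Tr}_{\mathrm{pur}}[V_N\sigma V_N^\dagger]$ have correlation range at most $\xi+4q$, distances being measured in original sites. -/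

import Mathlib

open scoped Matrix ComplexOrder

namespace MPI

/-- A site tensor of a homogeneous matrix product operator: `V o p i` is the `D × D` matrix on the
bond space with physical output `o`, purification output `p` and physical input `i`. -/
abbrev Tensor (O P I : Type) (D : ℕ) : Type := O → P → I → Matrix (Fin D) (Fin D) ℂ

/-- Blocking of `q` consecutive sites: the bond space is unchanged, and the physical indices become
`q`-tuples. -/
def Tensor.blocked {O P I : Type} {D : ℕ} (V : Tensor O P I D) (q : ℕ) :
    Tensor (Fin q → O) (Fin q → P) (Fin q → I) D :=
  fun o p i => (List.ofFn fun k => V (o k) (p k) (i k)).prod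

/-- The operator `V_N` generated on a periodic chain of `N` sites. -/
def Tensor.mpo {O P I : Type} {D : ℕ} (V : Tensor O P I D) (N : ℕ) :
    Matrix (Fin N → O × P) (Fin N → I) ℂ :=
  Matrix.of fun s i => ((List.ofFn fun k => V (s k).1 (s k).2 (i k)).prod).trace

/-- `V` generates a homogeneous matrix product isometry: `V_N† V_N = 1` for all `N ≥ 1`. -/
def Tensor.IsHMPI {O P I : Type} [Fintype O] [Fintype P] [DecidableEq I] {D : ℕ}
    (V : Tensor O P I D) : Prop :=
  ∀ N : ℕ, 1 ≤ N → (V.mpo N)ᴴ * V.mpo N = 1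

/-! ### Brick-wall circuits on a ring of `2 * n` sites -/

/-- The left site `2k` of the `k`-th pair `(2k, 2k+1)`. -/
def leftSite {n : ℕ} (k : Fin n) : Fin (2 * n) := ⟨2 * k.1, by omega⟩

/-- The right site `2k+1` of the `k`-th pair `(2k, 2k+1)`. -/
def rightSite {n : ℕ} (k : Fin n) : Fin (2 * n) := ⟨2 * k.1 + 1, by omega⟩

/-- The lower layer: a gate `u` on every pair `(2k, 2k+1)`. It leaves a wire of dimension `l` at
site `2k` and a wire of dimension `r` at site `2k+1`. -/
def lowerLayer {I : Type} {l r : ℕ} (u : Matrix (Fin l × Fin r) (I × I) ℂ) (n : ℕ) :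
    Matrix (Fin n → Fin l × Fin r) (Fin (2 * n) → I) ℂ :=
  Matrix.of fun w i => ∏ k, u (w k) (i (leftSite k), i (rightSite k))

/-- The upper layer: a gate `v` on every pair `(2k+1, 2k+2)`, cyclically. It takes the wire of
dimension `r` at site `2k+1` and the wire of dimension `l` at site `2k+2`. -/
def upperLayer {S : Type} {l r : ℕ} (v : Matrix (S × S) (Fin r × Fin l) ℂ) (n : ℕ) :
    Matrix (Fin (2 * n) → S) (Fin n → Fin l × Fin r) ℂ :=
  Matrix.of fun s w =>
    ∏ k, v (s (rightSite k), s (leftSite (finRotate n k))) ((w k).2, (w (finRotate n k)).1)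

/-- The depth-two brick-wall circuit on `2 * n` sites with periodic boundary. -/
def brickwall {I S : Type} {l r : ℕ} (u : Matrix (Fin l × Fin r) (I × I) ℂ)
    (v : Matrix (S × S) (Fin r × Fin l) ℂ) (n : ℕ) :
    Matrix (Fin (2 * n) → S) (Fin (2 * n) → I) ℂ :=
  upperLayer v n * lowerLayer u n

/-! ### States of a chain and their correlations -/

/-- Density matrices of `N` sites with local basis `S`. -/
def IsState {S : Type} [Fintype S] {N : ℕ} (ρ : Matrix (Fin N → S) (Fin N → S) ℂ) : Prop :=
  ρ.PosSemidef ∧ ρ.trace = 1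

/-- The configuration that is `x` on `A` and `e` outside `A`. -/
def glue {S : Type} {N : ℕ} (A : Finset (Fin N)) (x : A → S) (e : (Aᶜ : Finset (Fin N)) → S) :
    Fin N → S :=
  fun k => if h : k ∈ A then x ⟨k, h⟩ else e ⟨k, Finset.mem_compl.2 h⟩

/-- The reduced state on the region `A` (partial trace over the complement). -/
def reducedState {S : Type} [Fintype S] {N : ℕ} (ρ : Matrix (Fin N → S) (Fin N → S) ℂ)
    (A : Finset (Fin N)) : Matrix (A → S) (A → S) ℂ :=
  Matrix.of fun x y => ∑ e : (Aᶜ : Finset (Fin N)) → S, ρ (glue A x e) (glue A y e)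

/-- Distance of two sites on a ring of `N` sites. -/
def ringDist {N : ℕ} (i j : Fin N) : ℕ :=
  min ((i : ℤ) - (j : ℤ)).natAbs (N - ((i : ℤ) - (j : ℤ)).natAbs)

/-- `ρ` has correlation range at most `ξ`: the reduced state on `A ∪ B` is
`ρ_A ⊗ ρ_B` for all regions `A`, `B` at distance more than `ξ`. -/
def HasCorrelationRange {S : Type} [Fintype S] {N : ℕ} (ρ : Matrix (Fin N → S) (Fin N → S) ℂ)
    (ξ : ℕ) : Prop :=
  ∀ A B : Finset (Fin N), (∀ a ∈ A, ∀ b ∈ B, ξ < ringDist a b) →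
    ∀ x y : (A ∪ B : Finset (Fin N)) → S,
      reducedState ρ (A ∪ B) x y =
        reducedState ρ A (Finset.restrict₂ (π := fun _ => S) Finset.subset_union_left x)
            (Finset.restrict₂ (π := fun _ => S) Finset.subset_union_left y) *
          reducedState ρ B (Finset.restrict₂ (π := fun _ => S) Finset.subset_union_right x)
            (Finset.restrict₂ (π := fun _ => S) Finset.subset_union_right y)

/-- The output `V_N σ V_N†`, purification space included. -/
noncomputable def Tensor.dilatedOutput {O P I : Type} [Fintype I] {D : ℕ} (V : Tensor O P I D)
    (N : ℕ) (σ : Matrix (Fin N → I) (Fin N → I) ℂ) :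
    Matrix (Fin N → O × P) (Fin N → O × P) ℂ :=
  V.mpo N * σ * (V.mpo N)ᴴ

/-- The homogeneous locally purified channel `σ ↦ Tr_pur [V_N σ V_N†]`. -/
noncomputable def Tensor.channel {O P I : Type} [Fintype P] [Fintype I] {D : ℕ}
    (V : Tensor O P I D) (N : ℕ) (σ : Matrix (Fin N → I) (Fin N → I) ℂ) :
    Matrix (Fin N → O) (Fin N → O) ℂ :=
  Matrix.of fun o o' =>
    ∑ p : Fin N → P, V.dilatedOutput N σ (fun k => (o k, p k)) (fun k => (o' k, p k))

/-- On every ring, `V_N` and the channel that it purifies increase the correlation range of a state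
by at most the constant `c`. -/
def Tensor.SpreadsCorrelationsAtMost {O P I : Type} [Fintype O] [Fintype P] [Fintype I] {D : ℕ}
    (V : Tensor O P I D) (c : ℕ) : Prop :=
  ∀ N : ℕ, 1 ≤ N → ∀ σ : Matrix (Fin N → I) (Fin N → I) ℂ, IsState σ →
    ∀ ξ : ℕ, HasCorrelationRange σ ξ →
      HasCorrelationRange (V.dilatedOutput N σ) (ξ + c) ∧
        HasCorrelationRange (V.channel N σ) (ξ + c)

end MPI

namespace MPI

/-! ### Matrices whose powers have prescribed traces -/

section Trace

variable {n : Type*} [Fintype n] [DecidableEq n]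

/-! Everything rests on the double-layer transfer matrices `T (i, j)`, the sum over outputs of `conj
(V^j) ⊗ V^i`, of size `D^2`. The entries of `V_N† V_N` are the traces of words of length `N` in
them, so the isometry condition says exactly that the trace of every nonempty word is the product of
the deltas of its letters (`TraceDelta`).

Fix a vacuum input `i₀` and put `E = T (i₀, i₀)`. All positive powers of `E` have trace one, so `P =
E ^ (D^2)` is a rank-one projector with `E * P = P` (`isIdempotentElem_pow_card`). Words in `S x = T
x - δ x • P` are traceless, hence span a nil algebra of matrices, and such an algebra is nilpotent:
`D^2` of its letters multiply to zero (`prod_eq_zero_of_nil`). From this, `w * w' = w * P * w'` for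
any two words in the `T x` of length at least `D^2` (`prod_mul_prod_eq_of_trace`). Since `P * X * P`
is a multiple of `P`, the ring decouples at each bond where `P` is inserted. The blocking length is
`q = D^2`.

Correlations: a product observable on distant regions has as Heisenberg picture the trace of a word
that is made of letters `T x` away from the regions. Inserting `P` at the cut bonds splits it into
two observables supported on the `q`-neighbourhoods, and the hypothesis on the input applies to
these (`Tensor.IsSimple.heisenberg_eq`).

Circuit: after blocking, `T x * T y = T x * E * T y` with `E` of rank one. Splitting `E` along the
maximally entangled bond vector writes the Gram matrix of the two-site operator with open bonds as
`G' ⊗ G`, both factors positive. Factoring them as `G = Y† Y`, `Y * Z = 1`, and likewise `G'`, gives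
`u` from `Y, Y'` and `v` from the two-site operator and `Z, Z'`. The circuit agrees with the given
operator because all their mutual overlaps are the identity (`exists_brickwall`). -/

lemma trace_aeval_X_mul {A : Matrix n n ℂ} {c : ℂ} (h : ∀ k : ℕ, (A ^ (k + 1)).trace = c ^ (k + 1))
    (p : Polynomial ℂ) :
    (Polynomial.aeval A (Polynomial.X * p)).trace = (Polynomial.X * p).eval c := by
  induction p using Polynomial.induction_on' with
  | add p q hp hq => rw [mul_add, map_add, Matrix.trace_add, hp, hq, Polynomial.eval_add]
  | monomial k a =>
    rw [Polynomial.X_mul_monomial, Polynomial.aeval_monomial, Polynomial.eval_monomial,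
      ← Algebra.smul_def, Matrix.trace_smul, h, smul_eq_mul]

/-- In characteristic zero the trace of an idempotent is its rank. -/
lemma eq_zero_of_isIdempotentElem_of_trace {P : Matrix n n ℂ} (h : IsIdempotentElem P)
    (ht : P.trace = 0) : P = 0 := by
  have h1 : IsIdempotentElem (Matrix.toLin' P) := by
    unfold IsIdempotentElem
    rw [Module.End.mul_eq_comp, ← Matrix.toLin'_mul, h.eq]
  have := LinearMap.IsIdempotentElem.eq_zero_of_trace_eq_zero h1 (by simpa using ht)
  simpa using this

/-- A matrix all of whose powers are traceless is nilpotent. -/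
lemma pow_card_eq_zero_of_trace_pow {A : Matrix n n ℂ}
    (h : ∀ k : ℕ, (A ^ (k + 1)).trace = 0) : A ^ Fintype.card n = 0 := by
  obtain ⟨g, hg, hdvd⟩ := Polynomial.exists_eq_pow_rootMultiplicity_mul_and_not_dvd A.charpoly
    A.charpoly_monic.ne_zero 0
  set a := A.charpoly.rootMultiplicity 0
  have ha : a ≤ Fintype.card n := by
    have h1 : a ≤ A.charpoly.roots.card := by
      change A.charpoly.rootMultiplicity 0 ≤ _
      rw [← Polynomial.count_roots]; exact Multiset.count_le_card _ _
    exact h1.trans ((Polynomial.card_roots' _).trans A.charpoly_natDegree_eq_dim.le)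
  rw [map_zero, sub_zero] at hg hdvd
  -- Bézout yields the idempotent `e`, a polynomial in `A` projecting onto the nonzero spectrum. The
  -- exponent `a + 1` instead of `a` makes this polynomial divisible by `X` even when `a = 0`, so
  -- that the trace hypothesis applies to it.
  have hcop : IsCoprime (Polynomial.X ^ (a + 1)) g :=
    IsCoprime.pow_left ((Polynomial.irreducible_X.coprime_iff_not_dvd).2 hdvd)
  obtain ⟨u, v, huv⟩ := hcop
  have hch : Polynomial.aeval A A.charpoly = 0 := A.aeval_self_charpoly
  set e := Polynomial.aeval A (u * Polynomial.X ^ (a + 1)) with he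
  have h1 : e + Polynomial.aeval A (v * g) = 1 := by rw [he, ← map_add, huv, map_one]
  have h2 : e * Polynomial.aeval A (v * g) = 0 := by
    rw [he, ← map_mul, show u * Polynomial.X ^ (a + 1) * (v * g) = u * Polynomial.X * v *
      (Polynomial.X ^ a * g) by ring, ← hg, map_mul, hch, mul_zero]
  have hid : IsIdempotentElem e := by
    have : e * (e + Polynomial.aeval A (v * g)) = e := by rw [h1, mul_one]
    rwa [mul_add, h2, add_zero] at this
  have he0 : e = 0 := by
    refine eq_zero_of_isIdempotentElem_of_trace hid ?_
    rw [he, show u * Polynomial.X ^ (a + 1) = Polynomial.X * (u * Polynomial.X ^ a) by ring,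
      trace_aeval_X_mul (c := 0) (by simpa using h)]
    simp
  rw [he0, zero_add] at h1
  have h3 : A ^ a = 0 := by
    have : Polynomial.aeval A (Polynomial.X ^ a * (v * g)) = 0 := by
      rw [show Polynomial.X ^ a * (v * g) = v * (Polynomial.X ^ a * g) by ring, ← hg, map_mul, hch,
        mul_zero]
    rwa [map_mul, h1, mul_one, map_pow, Polynomial.aeval_X] at this
  exact pow_eq_zero_of_le ha h3

lemma exists_vecMulVec_of_trace_eq_one {P : Matrix n n ℂ} (h : IsIdempotentElem P)
    (ht : P.trace = 1) : ∃ a b : n → ℂ, P = Matrix.vecMulVec a b := by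
  have h1 : IsIdempotentElem (Matrix.toLin' P) := by
    unfold IsIdempotentElem
    rw [Module.End.mul_eq_comp, ← Matrix.toLin'_mul, h.eq]
  have h2 := (LinearMap.IsIdempotentElem.isProj_range _ h1).trace
  have h3 : Module.finrank ℂ (LinearMap.range (Matrix.toLin' P)) = 1 := by
    have : (Matrix.toLin' P).trace ℂ _ = 1 := by simpa using ht
    rw [this] at h2; exact_mod_cast h2.symm
  obtain ⟨⟨a, ha⟩, -, hs⟩ := finrank_eq_one_iff'.1 h3
  have h4 : ∀ j, ∃ c : ℂ, c • a = P.col j := by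
    intro j
    obtain ⟨c, hc⟩ := hs ⟨P *ᵥ Pi.single j 1, ⟨Pi.single j 1, by simp⟩⟩
    refine ⟨c, ?_⟩
    have := congrArg Subtype.val hc
    simpa using this
  choose b hb using h4
  refine ⟨a, b, ?_⟩
  ext i j
  have := congrFun (hb j) i
  simp only [Pi.smul_apply, smul_eq_mul, Matrix.col_apply] at this
  rw [Matrix.vecMulVec_apply, ← this, mul_comm]

/-- Writing `P = a bᵀ`, the middle of `P * X * P` is the scalar `b ⬝ X a`. This is what decouples
the two sides of a bond carrying `P`. -/
lemma mul_mul_eq_trace_smul {P : Matrix n n ℂ} (h : IsIdempotentElem P) (ht : P.trace = 1)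
    (X : Matrix n n ℂ) : P * X * P = (P * X).trace • P := by
  obtain ⟨a, b, rfl⟩ := exists_vecMulVec_of_trace_eq_one h ht
  rw [Matrix.vecMulVec_mul, Matrix.vecMulVec_mul_vecMulVec, Matrix.trace_vecMulVec]
  rw [Matrix.vecMulVec_smul, dotProduct_comm]

/-- A matrix all of whose powers have trace one becomes, after sufficiently many powers, a projector
of rank one that absorbs it. -/
lemma isIdempotentElem_pow_card {E : Matrix n n ℂ} (h : ∀ k : ℕ, (E ^ (k + 1)).trace = 1) :
    IsIdempotentElem (E ^ Fintype.card n) ∧ E * E ^ Fintype.card n = E ^ Fintype.card n := by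
  set m := Fintype.card n with hm
  have hn : Nonempty n := by
    by_contra hn
    rw [not_nonempty_iff] at hn
    have := h 0
    simp [Matrix.trace] at this
  have hm0 : 0 < m := Fintype.card_pos
  have htr := trace_aeval_X_mul (A := E) (c := 1) (by simpa using h)
  -- Both `X ^ m ∣ p` and `(1 - X) ^ m ∣ 1 - p`. Once `(E * (1 - E)) ^ m = 0`, the value `p(E)` is
  -- therefore the spectral projector of `E` at the eigenvalue one.
  set p : Polynomial ℂ := 1 - (1 - Polynomial.X ^ m) ^ m with hp
  obtain ⟨r, hr⟩ : Polynomial.X ^ m ∣ p := by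
    have := sub_dvd_pow_sub_pow (1 : Polynomial ℂ) (1 - Polynomial.X ^ m) m
    simpa [hp] using this
  obtain ⟨t, ht⟩ : (1 - Polynomial.X) ^ m ∣ 1 - p := by
    have := pow_dvd_pow_of_dvd (sub_dvd_pow_sub_pow (1 : Polynomial ℂ) Polynomial.X m) m
    simpa [hp] using this
  obtain ⟨m', hm'⟩ : ∃ m', m = m' + 1 := ⟨m - 1, by omega⟩
  have hr' : p = Polynomial.X * (Polynomial.X ^ m' * r) := by rw [hr, hm']; ring
  have hp1 : p.eval 1 = 1 := by simp [hp, hm0.ne']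
  have h0 : (E * (1 - E)) ^ m = 0 := by
    refine pow_card_eq_zero_of_trace_pow fun k => ?_
    have := htr (Polynomial.X ^ k * (1 - Polynomial.X) ^ (k + 1))
    rw [show (Polynomial.X : Polynomial ℂ) * (Polynomial.X ^ k * (1 - Polynomial.X) ^ (k + 1)) =
      (Polynomial.X * (1 - Polynomial.X)) ^ (k + 1) by rw [mul_pow]; ring] at this
    simpa using this
  set P := Polynomial.aeval E p with hP
  have hid : P * P = P := by
    have h1 : Polynomial.aeval E (p * (1 - p)) = 0 := by
      rw [ht, hr, show Polynomial.X ^ m * r * ((1 - Polynomial.X) ^ m * t) =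
        (Polynomial.X * (1 - Polynomial.X)) ^ m * (r * t) by rw [mul_pow]; ring, map_mul]
      simp [h0]
    rw [mul_sub, mul_one, map_sub, map_mul, sub_eq_zero] at h1
    exact h1.symm
  have htP : P.trace = 1 := by rw [hP, hr', htr, ← hr', hp1]
  have hcomm : E * P = P * E := by
    have := congrArg (Polynomial.aeval E) (mul_comm Polynomial.X p)
    simpa using this
  have hPE : P * E = P := by
    have h1 := mul_mul_eq_trace_smul hid htP E
    have h2 : (P * E).trace = 1 := by
      have := htr p
      rw [mul_comm] at this
      simpa [hp1] using this
    rw [h2, one_smul, mul_assoc, hcomm, ← mul_assoc, hid] at h1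
    exact h1
  -- `X - p` vanishes at 0 and at 1, so all positive powers of `E - P` are traceless. As `E - P` and
  -- `P` annihilate each other, `E ^ m` is then `P`.
  have hA : (E - P) ^ m = 0 := by
    refine pow_card_eq_zero_of_trace_pow fun k => ?_
    have := htr ((1 - Polynomial.X ^ m' * r) ^ (k + 1) * Polynomial.X ^ k)
    rw [show (Polynomial.X : Polynomial ℂ) * ((1 - Polynomial.X ^ m' * r) ^ (k + 1) *
      Polynomial.X ^ k) = (Polynomial.X - Polynomial.X * (Polynomial.X ^ m' * r)) ^ (k + 1) by
        rw [show (Polynomial.X - Polynomial.X * (Polynomial.X ^ m' * r) : Polynomial ℂ) =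
          Polynomial.X * (1 - Polynomial.X ^ m' * r) by ring, mul_pow]; ring, ← hr'] at this
    simpa [hp1] using this
  have hpow : ∀ k, E ^ (k + 1) = (E - P) ^ (k + 1) + P := by
    intro k
    induction k with
    | zero => simp
    | succ k ih =>
      have hPA : P * (E - P) = 0 := by rw [mul_sub, hPE, hid, sub_self]
      have hAP : (E - P) * P = 0 := by rw [sub_mul, hcomm, hPE, hid, sub_self]
      have h1 : (E - P) ^ (k + 1) * P = 0 := by rw [pow_succ, mul_assoc, hAP, mul_zero]
      rw [pow_succ, ih, pow_succ _ (k + 1)]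
      conv_lhs => rw [show E = (E - P) + P by simp]
      rw [sub_add_cancel, add_mul, hPE, mul_sub, h1, sub_zero]
  have hEP : E ^ m = P := by
    rw [hm', hpow, ← hm', hA, zero_add]
  rw [hEP]
  exact ⟨hid, by rw [hcomm, hPE]⟩

end Trace

/-! ### Nil algebras of matrices are nilpotent -/

section Nil

variable {n : Type*} [Fintype n] [DecidableEq n]

/-- An Engel-type argument. Choose `v` outside `K` with `N v + K` of least dimension. If some `x v`
were outside `K`, minimality would give `N (x v) + K = N v + K`, so `x v ≡ y x v` modulo `K` for
some `y` in `N`; iterating with `y` nilpotent puts `x v` in `K`. -/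
lemma exists_mulVec_mem_of_nil (N : Submodule ℂ (Matrix n n ℂ))
    (hmul : ∀ x ∈ N, ∀ y ∈ N, x * y ∈ N) (hnil : ∀ x ∈ N, IsNilpotent x)
    (K : Submodule ℂ (n → ℂ)) (hK : ∀ x ∈ N, ∀ v ∈ K, x *ᵥ v ∈ K) (hne : K ≠ ⊤) :
    ∃ v ∉ K, ∀ x ∈ N, x *ᵥ v ∈ K := by
  let orb : (n → ℂ) → Submodule ℂ (n → ℂ) := fun v =>
    N.map ((Matrix.mulVecBilin ℂ ℂ).flip v) ⊔ K
  have horb : ∀ v w, w ∈ orb v ↔ ∃ x ∈ N, ∃ k ∈ K, x *ᵥ v + k = w := by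
    intro v w
    simp [orb, Submodule.mem_sup]
  obtain ⟨v₀, -, hv₀⟩ := SetLike.exists_of_lt (lt_top_iff_ne_top.2 hne)
  let v := Function.argminOn (fun v => Module.finrank ℂ (orb v)) {v | v ∉ K} ⟨v₀, hv₀⟩
  have hv : v ∉ K := Function.argminOn_mem (fun v => Module.finrank ℂ (orb v)) {v | v ∉ K} ⟨v₀, hv₀⟩
  refine ⟨v, hv, fun x hx => ?_⟩
  by_contra hxv
  have hle : orb (x *ᵥ v) ≤ orb v := by
    intro w hw
    obtain ⟨y, hy, k, hk, rfl⟩ := (horb _ _).1 hw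
    exact (horb _ _).2 ⟨y * x, hmul _ hy _ hx, k, hk, by rw [Matrix.mulVec_mulVec]⟩
  have heq : orb (x *ᵥ v) = orb v :=
    Submodule.eq_of_le_of_finrank_le hle
      (Function.argminOn_le (fun v => Module.finrank ℂ (orb v)) {v | v ∉ K} hxv)
  have hmem : x *ᵥ v ∈ orb (x *ᵥ v) := by
    rw [heq]; exact (horb _ _).2 ⟨x, hx, 0, K.zero_mem, by simp⟩
  obtain ⟨y, hy, k, hk, hyk⟩ := (horb _ _).1 hmem
  have hiter : ∀ m : ℕ, x *ᵥ v - (y ^ m) *ᵥ (x *ᵥ v) ∈ K := by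
    intro m
    induction m with
    | zero => simp
    | succ m ih =>
      have h1 : y *ᵥ (x *ᵥ v - (y ^ m) *ᵥ (x *ᵥ v)) ∈ K := hK y hy _ ih
      have h2 := K.add_mem h1 hk
      rw [Matrix.mulVec_sub, Matrix.mulVec_mulVec _ y (y ^ m), ← pow_succ'] at h2
      convert h2 using 1
      nth_rewrite 1 [← hyk]
      abel
  obtain ⟨m, hm⟩ := hnil y hy
  have := hiter m
  rw [hm, Matrix.zero_mulVec, sub_zero] at this
  exact hxv this

/-- In a multiplicatively closed space of nilpotent `n × n` matrices, any product of `n` elements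
vanishes. -/
lemma prod_eq_zero_of_nil (N : Submodule ℂ (Matrix n n ℂ))
    (hmul : ∀ x ∈ N, ∀ y ∈ N, x * y ∈ N) (hnil : ∀ x ∈ N, IsNilpotent x)
    (w : List (Matrix n n ℂ)) (hw : ∀ x ∈ w, x ∈ N) (hlen : Fintype.card n ≤ w.length) :
    w.prod = 0 := by
  let next : Submodule ℂ (n → ℂ) → Submodule ℂ (n → ℂ) := fun K =>
    ⨅ x : N, K.comap (Matrix.mulVecLin x.1)
  have hnext : ∀ K v, v ∈ next K ↔ ∀ x ∈ N, x *ᵥ v ∈ K := by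
    intro K v; simp [next]
  -- A flag on which each element of `N` lowers the level by one. It grows strictly until it is
  -- everything, hence is everything at level `card n`.
  let K : ℕ → Submodule ℂ (n → ℂ) := fun k => next^[k] ⊥
  have hKs : ∀ k, K (k + 1) = next (K k) := fun k => Function.iterate_succ_apply' _ _ _
  have hinv : ∀ k, K k ≤ K (k + 1) := by
    intro k
    induction k with
    | zero => exact bot_le
    | succ k ih =>
      intro v hv
      rw [hKs, hnext] at hv ⊢
      exact fun x hx => ih (hv x hx)
  have hdim : ∀ k, K k = ⊤ ∨ k ≤ Module.finrank ℂ (K k) := by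
    intro k
    induction k with
    | zero => right; exact Nat.zero_le _
    | succ k ih =>
      rcases ih with h | h
      · left; exact top_le_iff.1 (h ▸ hinv k)
      · by_cases ht : K k = ⊤
        · left; exact top_le_iff.1 (ht ▸ hinv k)
        · right
          obtain ⟨v, hv, hv'⟩ := exists_mulVec_mem_of_nil N hmul hnil (K k)
            (fun x hx v hv => by
              have := hinv k hv
              rw [hKs, hnext] at this
              exact this x hx) ht
          have hlt : K k < K (k + 1) := by
            refine lt_of_le_of_ne (hinv k) fun h => hv ?_
            rw [h, hKs, hnext]; exact hv'
          exact Nat.succ_le_of_lt (lt_of_le_of_lt h (Submodule.finrank_lt_finrank_of_lt hlt))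
  have htop : ∀ k, Fintype.card n ≤ k → K k = ⊤ := by
    intro k hk
    rcases hdim k with h | h
    · exact h
    · refine Submodule.eq_top_of_finrank_eq (le_antisymm (Submodule.finrank_le _) ?_)
      simpa using hk.trans h
  have hact : ∀ w : List (Matrix n n ℂ), (∀ x ∈ w, x ∈ N) → ∀ v ∈ K w.length, w.prod *ᵥ v = 0 := by
    intro w
    induction w using List.reverseRecOn with
    | nil => intro _ v hv; simpa [K] using hv
    | append_singleton w x ih =>
      intro hw v hv
      rw [List.prod_append, List.prod_singleton, ← Matrix.mulVec_mulVec]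
      refine ih (fun y hy => hw y (by simp [hy])) _ ?_
      rw [List.length_append, List.length_singleton, hKs, hnext] at hv
      exact hv x (hw x (by simp))
  ext i j
  have := congrFun (hact w hw (Pi.single j 1) (by rw [htop _ hlen]; trivial)) i
  simpa using this

end Nil

/-! ### Words whose traces are products of deltas -/

section Words

variable {n κ : Type*} [Fintype n] [DecidableEq n]

/-- Inside a closed word, the letter `T k` and its substitute `δ k • T k₀ ^ m` both contribute the
factor `δ k`, so their difference contributes zero. The condition `0 < m` keeps the substituted word
nonempty. -/
lemma trace_mul_prod_sub {T : κ → Matrix n n ℂ} {δ : κ → ℂ} (k₀ : κ) (hk₀ : δ k₀ = 1) {m : ℕ}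
    (hm : 0 < m)
    (h : ∀ w : List κ, w ≠ [] → (w.map T).prod.trace = (w.map δ).prod) (w : List κ) (hw : w ≠ []) :
    ∀ u : List κ, ((u.map T).prod * (w.map fun k => T k - δ k • T k₀ ^ m).prod).trace = 0 := by
  have hpow : (((List.replicate m k₀).map T).prod) = T k₀ ^ m := by simp
  induction w with
  | nil => exact absurd rfl hw
  | cons k w ih =>
    intro u
    by_cases hw' : w = []
    · subst hw'
      have h1 := h (u ++ [k]) (by simp)
      have h2 := h (u ++ List.replicate m k₀) (by simp [hm.ne'])
      simp only [List.map_append, List.prod_append, List.map_cons, List.map_nil,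
        List.prod_singleton] at h1 h2
      rw [hpow] at h2
      simp [mul_sub, h1, h2, hk₀]
      ring
    · have h1 := ih hw' (u ++ [k])
      have h2 := ih hw' (u ++ List.replicate m k₀)
      simp only [List.map_append, List.prod_append, hpow, List.map_cons, List.map_nil,
        List.prod_singleton] at h1 h2
      rw [List.map_cons, List.prod_cons, ← mul_assoc, mul_sub, sub_mul, Matrix.trace_sub, h1,
        Matrix.mul_smul, Matrix.smul_mul, Matrix.trace_smul, h2]
      simp

/-- If the traces of all words in the matrices `T k` are products of deltas, then the power `P` of
`T k₀` may be inserted between two long words. -/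
lemma prod_mul_prod_eq_of_trace {T : κ → Matrix n n ℂ} {δ : κ → ℂ} (k₀ : κ) (hk₀ : δ k₀ = 1)
    (h : ∀ w : List κ, w ≠ [] → (w.map T).prod.trace = (w.map δ).prod) (w w' : List κ)
    (hw : Fintype.card n ≤ w.length) (hw' : Fintype.card n ≤ w'.length) :
    (w.map T).prod * (w'.map T).prod =
      (w.map T).prod * T k₀ ^ Fintype.card n * (w'.map T).prod := by
  have hE : ∀ k : ℕ, (T k₀ ^ (k + 1)).trace = 1 := by
    intro k
    have := h (List.replicate (k + 1) k₀) (by simp)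
    simpa [hk₀] using this
  have hn : Nonempty n := by
    by_contra hn
    rw [not_nonempty_iff] at hn
    have := hE 0
    simp [Matrix.trace] at this
  have hm : 0 < Fintype.card n := Fintype.card_pos
  obtain ⟨hid, -⟩ := isIdempotentElem_pow_card hE
  have htr := trace_mul_prod_sub k₀ hk₀ hm h
  set P := T k₀ ^ Fintype.card n with hP
  set S : κ → Matrix n n ℂ := fun k => T k - δ k • P with hS
  have hTS : ∀ k, T k = S k + δ k • P := fun k => by simp [hS]
  have htP : P.trace = 1 := by
    obtain ⟨m, hm'⟩ := Nat.exists_eq_succ_of_ne_zero hm.ne'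
    rw [hP, hm']; exact hE m
  have hzero : ∀ w : List κ, Fintype.card n ≤ w.length → (w.map S).prod = 0 := by
    intro w hw
    -- The span of the nonempty `S`-words is closed under products and traceless; hence each of its
    -- elements has traceless powers and is nilpotent.
    let N : Submodule ℂ (Matrix n n ℂ) :=
      Submodule.span ℂ {x | ∃ w : List κ, w ≠ [] ∧ x = (w.map S).prod}
    have hmul : ∀ x ∈ N, ∀ y ∈ N, x * y ∈ N := by
      intro x hx y hy
      have hxy : x * y ∈ N * N := Submodule.mul_mem_mul hx hy
      rw [Submodule.span_mul_span] at hxy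
      refine Submodule.span_mono ?_ hxy
      rintro _ ⟨_, ⟨u, hu, rfl⟩, _, ⟨v, hv, rfl⟩, rfl⟩
      exact ⟨u ++ v, by simp [hu], by simp⟩
    have htrN : ∀ x ∈ N, x.trace = 0 := by
      intro x hx
      induction hx using Submodule.span_induction with
      | mem x hx =>
        obtain ⟨w, hw, rfl⟩ := hx
        simpa using htr w hw []
      | zero => simp
      | add x y _ _ hx hy => rw [Matrix.trace_add, hx, hy, add_zero]
      | smul a x _ hx => rw [Matrix.trace_smul, hx, smul_zero]
    have hnil : ∀ x ∈ N, IsNilpotent x := by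
      intro x hx
      refine ⟨_, pow_card_eq_zero_of_trace_pow fun k => htrN _ ?_⟩
      induction k with
      | zero => simpa using hx
      | succ k ih => rw [pow_succ]; exact hmul _ ih _ hx
    refine prod_eq_zero_of_nil N hmul hnil _ ?_ (by simpa using hw)
    intro x hx
    obtain ⟨k, -, rfl⟩ := List.mem_map.1 hx
    exact Submodule.subset_span ⟨[k], by simp, by simp⟩
  have hPSP : ∀ w : List κ, w ≠ [] → P * (w.map S).prod * P = 0 := by
    intro w hw
    rw [mul_mul_eq_trace_smul hid htP]
    have := htr w hw (List.replicate (Fintype.card n) k₀)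
    rw [List.map_replicate, List.prod_replicate] at this
    rw [this, zero_smul]
  -- For nonempty `u`, both `P u v P` and `P u P` vanish; for empty `u`, already `P * (1 - P) = 0`.
  have hPQP : ∀ u v : List κ, P * (u.map S).prod * (1 - P) * (v.map S).prod * P = 0 := by
    intro u v
    by_cases hu : u = []
    · subst hu
      have : P * (1 - P) = 0 := by rw [mul_sub, mul_one, hid.eq, sub_self]
      simp [this]
    · have h1 := hPSP (u ++ v) (by simp [hu])
      rw [List.map_append, List.prod_append, ← mul_assoc] at h1
      rw [mul_sub, mul_one, hPSP u hu, sub_zero, h1]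
  -- To the right of `P u (1 - P)`, each letter `T k = S k + δ k • P` may be replaced by `S k`,
  -- since the `P` part dies by `hPQP`.
  have hright : ∀ w' v u : List κ, P * (u.map S).prod * (1 - P) * (v.map S).prod * (w'.map T).prod =
      P * (u.map S).prod * (1 - P) * ((v ++ w').map S).prod := by
    intro w'
    induction w' with
    | nil => intro v u; simp
    | cons k w' ih =>
      intro v u
      have := ih (v ++ [k]) u
      rw [List.append_assoc, List.singleton_append] at this
      rw [← this, List.map_cons, List.prod_cons, ← mul_assoc, hTS k, mul_add, Matrix.mul_smul, hPQP]
      simp [mul_assoc]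
  -- Peeling letters off the left, the `P` part of each leaves `P * (S-word) * (1 - P) * w'`. By
  -- `hright` this ends in an `S`-word as long as `w'`, which is zero.
  have hleft : ∀ w : List κ, (w.map T).prod * (1 - P) * (w'.map T).prod =
      (w.map S).prod * (1 - P) * (w'.map T).prod := by
    intro w
    induction w with
    | nil => simp
    | cons k w ih =>
      have h1 := hright w' [] w
      rw [List.nil_append, hzero w' hw', mul_zero, List.map_nil, List.prod_nil, mul_one] at h1
      simp only [List.map_cons, List.prod_cons]
      rw [mul_assoc (T k), mul_assoc (T k), ih, hTS k, add_mul, Matrix.smul_mul, ← mul_assoc P,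
        ← mul_assoc P, h1, smul_zero, add_zero]
      simp only [mul_assoc]
  have := hleft w
  rw [hzero w hw, zero_mul, zero_mul, mul_sub, mul_one, sub_mul, sub_eq_zero] at this
  exact this

end Words

/-! ### Products along a ring with a projector inserted at every cut -/

section Chain

open scoped Kronecker

variable {R : Type*} [Monoid R]

/-- The product of the `m` consecutive letters `c s, …, c (s + m - 1)`. -/
def segment (c : ℕ → R) (s m : ℕ) : R := ((List.range m).map fun t => c (s + t)).prod

@[simp] lemma segment_zero (c : ℕ → R) (s : ℕ) : segment c s 0 = 1 := by simp [segment]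

lemma segment_succ (c : ℕ → R) (s m : ℕ) :
    segment c s (m + 1) = segment c s m * c (s + m) := by
  simp [segment, List.range_succ]

lemma segment_add (c : ℕ → R) (s m m' : ℕ) :
    segment c s (m + m') = segment c s m * segment c (s + m) m' := by
  induction m' with
  | zero => simp
  | succ m' ih => rw [← add_assoc, segment_succ, ih, segment_succ, mul_assoc, add_assoc]

lemma segment_succ' (c : ℕ → R) (s m : ℕ) :
    segment c s (m + 1) = c s * segment c (s + 1) m := by
  rw [add_comm, segment_add]
  congr 1
  simp [segment_succ]

lemma segment_add_period {c : ℕ → R} {N : ℕ} (hc : ∀ k, c (k + N) = c k) (s m : ℕ) :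
    segment c (s + N) m = segment c s m := by
  induction m with
  | zero => simp
  | succ m ih => rw [segment_succ, segment_succ, ih, add_right_comm, hc]

open Classical in
/-- The product of `m` consecutive letters starting with `c s`, with `P` inserted at the start and at
every cut bond; the bond `k` is the one to the left of the letter `c k`. -/
noncomputable def cutChain (cut : ℕ → Prop) (P : R) (c : ℕ → R) (s : ℕ) : ℕ → R
  | 0 => P
  | m + 1 => cutChain cut P c s m * c (s + m) * (if cut (s + m + 1) then P else 1)

/-- Long words in the letters `Vac` absorb `P`, which itself is such a word of length `q`. -/
structure Absorbs (Vac : Set R) (P : R) (q : ℕ) : Prop where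
  idem : P * P = P
  word : ∃ w : List R, (∀ x ∈ w, x ∈ Vac) ∧ w.length = q ∧ w.prod = P
  insert : ∀ w w' : List R, (∀ x ∈ w, x ∈ Vac) → (∀ x ∈ w', x ∈ Vac) → q ≤ w.length →
    q ≤ w'.length → w.prod * w'.prod = w.prod * P * w'.prod

/-- Insertions of `P` do not interrupt a run of vacuum letters, because `P` is itself a vacuum word.
If the run reaches back past the start of the chain, the initial `P` supplies the missing letters;
it has only `q` of them, whence `m ≤ q`. -/
lemma cutChain_eq_mul_word {Vac : Set R} {P : R} {q : ℕ} (h : Absorbs Vac P q) (cut : ℕ → Prop)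
    (c : ℕ → R) (s k : ℕ) : ∀ m ≤ q, (∀ t, s + k ≤ t + m → t < s + k → c t ∈ Vac) →
      ∃ (Z : R) (w : List R), (∀ x ∈ w, x ∈ Vac) ∧ m ≤ w.length ∧
        cutChain cut P c s k = Z * w.prod := by
  induction k with
  | zero =>
    intro m hm _
    obtain ⟨w, hw, hl, hp⟩ := h.word
    exact ⟨1, w, hw, hl ▸ hm, by rw [cutChain, one_mul, hp]⟩
  | succ k ih =>
    intro m hm hv
    cases m with
    | zero => exact ⟨_, [], by simp, by simp, by simp; rfl⟩
    | succ m =>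
      obtain ⟨Z, w, hw, hl, hp⟩ := ih m (by omega) fun t h1 h2 => hv t (by omega) (by omega)
      have hc : c (s + k) ∈ Vac := hv _ (by omega) (by omega)
      obtain ⟨w', hw', -, hp'⟩ := h.word
      by_cases hcut : cut (s + k + 1)
      · refine ⟨Z, w ++ [c (s + k)] ++ w', ?_, ?_, ?_⟩
        · intro x hx
          simp only [List.mem_append, List.mem_singleton] at hx
          rcases hx with (hx | rfl) | hx
          exacts [hw x hx, hc, hw' x hx]
        · simp; omega
        · simp [cutChain, hcut, hp, hp', mul_assoc]
      · refine ⟨Z, w ++ [c (s + k)], ?_, ?_, ?_⟩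
        · intro x hx
          simp only [List.mem_append, List.mem_singleton] at hx
          rcases hx with hx | rfl
          exacts [hw x hx, hc]
        · simp; omega
        · simp [cutChain, hcut, hp, mul_assoc]

/-- The mirror image on the right of a cut: the final `P` supplies the letters that a short segment
lacks. -/
lemma segment_mul_eq_word_mul {Vac : Set R} {P : R} {q : ℕ} (h : Absorbs Vac P q)
    (c : ℕ → R) (k : ℕ) : ∀ s, ∀ m ≤ q, (∀ t, s ≤ t → t < s + m → c t ∈ Vac) →
      ∃ (Z : R) (w : List R), (∀ x ∈ w, x ∈ Vac) ∧ m ≤ w.length ∧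
        segment c s k * P = w.prod * Z := by
  induction k with
  | zero =>
    intro s m hm _
    obtain ⟨w, hw, hl, hp⟩ := h.word
    exact ⟨1, w, hw, hl ▸ hm, by rw [segment_zero, one_mul, mul_one, hp]⟩
  | succ k ih =>
    intro s m hm hv
    cases m with
    | zero => exact ⟨_, [], by simp, by simp, by simp; rfl⟩
    | succ m =>
      obtain ⟨Z, w, hw, hl, hp⟩ := ih (s + 1) m (by omega) fun t h1 h2 =>
        hv t (by omega) (by omega)
      have hc : c s ∈ Vac := hv _ (by omega) (by omega)
      refine ⟨Z, c s :: w, ?_, ?_, ?_⟩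
      · intro x hx
        rcases List.mem_cons.1 hx with rfl | hx
        exacts [hc, hw x hx]
      · simp; omega
      · rw [segment_succ', mul_assoc, hp, List.prod_cons, mul_assoc]

/-- The projectors in `cutChain` are absorbed by the vacuum letters around the cuts. -/
lemma cutChain_mul_segment {Vac : Set R} {P : R} {q : ℕ} (h : Absorbs Vac P q) {cut : ℕ → Prop}
    {c : ℕ → R} {s : ℕ}
    (hcut : ∀ k, s ≤ k → cut k → ∀ t, k ≤ t + q → t < k + q → c t ∈ Vac) (N : ℕ) :
    ∀ k ≤ N, cutChain cut P c s k * (segment c (s + k) (N - k) * P) =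
      P * segment c s N * P := by
  intro k
  induction k with
  | zero => intro _; simp [cutChain, mul_assoc]
  | succ k ih =>
    intro hk
    rw [← ih (by omega), show N - k = (N - (k + 1)) + 1 by omega, segment_succ', ← add_assoc]
    by_cases hc : cut (s + k + 1)
    · have hw := hcut _ (by omega) hc
      obtain ⟨Z', w', hw', hl', hp'⟩ := segment_mul_eq_word_mul h c (N - (k + 1)) (s + k + 1) q le_rfl
        (fun t h1 h2 => hw t (by omega) (by omega))
      -- The letter `c (s + k)` is one of the `q` required, so `cutChain` only has to supply `q -
      -- 1`; this is why `q = 0` is separate.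
      have hleft : ∃ (Z : R) (w : List R), (∀ x ∈ w, x ∈ Vac) ∧ q ≤ w.length ∧
          cutChain cut P c s k * c (s + k) = Z * w.prod := by
        cases q with
        | zero => exact ⟨_, [], by simp, by simp, by simp; rfl⟩
        | succ q =>
          obtain ⟨Z, w, hw₁, hl, hp⟩ := cutChain_eq_mul_word h cut c s k q (by omega)
            (fun t h1 h2 => hw t (by omega) (by omega))
          have hc : c (s + k) ∈ Vac := hw _ (by omega) (by omega)
          refine ⟨Z, w ++ [c (s + k)], ?_, ?_, ?_⟩
          · intro x hx
            simp only [List.mem_append, List.mem_singleton] at hx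
            rcases hx with hx | rfl
            exacts [hw₁ x hx, hc]
          · simp; omega
          · simp [hp, mul_assoc]
      obtain ⟨Z, w, hw₁, hl, hp⟩ := hleft
      simp only [cutChain, hc, if_true]
      rw [mul_assoc (c (s + k)), ← mul_assoc _ (c (s + k)), hp, hp', mul_assoc Z, mul_assoc Z,
        mul_assoc Z, ← mul_assoc _ w'.prod, ← h.insert w w' hw₁ hw' hl hl', mul_assoc w.prod]
    · simp [cutChain, hc, mul_assoc]

end Chain

/-! ### Ring traces and their factorization at cuts -/

section Ring

open scoped Kronecker

variable {n : Type*} [Fintype n] [DecidableEq n]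

lemma trace_segment_eq {c : ℕ → Matrix n n ℂ} {N : ℕ} (hc : ∀ k, c (k + N) = c k) (s : ℕ) :
    (segment c s N).trace = (segment c 0 N).trace := by
  induction s with
  | zero => rfl
  | succ s ih =>
    rw [← ih]
    cases N with
    | zero => simp
    | succ N =>
      rw [segment_succ' c s, segment_succ c (s + 1), Matrix.trace_mul_comm, ← hc s,
        show s + (N + 1) = s + 1 + N by omega]

/-- On a ring with at least one cut, inserting `P` at all cuts does not change the trace. -/
lemma trace_segment_eq_trace_cutChain {Vac : Set (Matrix n n ℂ)} {P : Matrix n n ℂ} {q : ℕ}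
    (h : Absorbs Vac P q) {cut : ℕ → Prop} {c : ℕ → Matrix n n ℂ} {s N : ℕ}
    (hcut : ∀ k, s ≤ k → cut k → ∀ t, k ≤ t + q → t < k + q → c t ∈ Vac)
    (hc : ∀ k, c (k + N) = c k) (hs : q ≤ s) (hN : 2 * q ≤ N) (hN0 : 0 < N)
    (hcs : cut s) (hcs' : cut (s + N)) :
    (segment c 0 N).trace = (cutChain cut P c s N).trace := by
  -- Starting the ring at `s - q` puts the cut bond `s` between two vacuum words of length `q`,
  -- where `P` may be inserted; `2 * q ≤ N` makes room for both. Cyclicity then moves the start to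
  -- `s`.
  have h1 : (segment c 0 N).trace = (P * segment c s N * P).trace := by
    obtain ⟨s', rfl⟩ := Nat.exists_eq_add_of_le' hs
    obtain ⟨N', rfl⟩ := Nat.exists_eq_add_of_le hN
    have hword : ∀ a m, (∀ t, a ≤ t → t < a + m → c t ∈ Vac) → ∃ w : List (Matrix n n ℂ),
        (∀ x ∈ w, x ∈ Vac) ∧ w.length = m ∧ segment c a m = w.prod := by
      intro a m hv
      refine ⟨_, ?_, ?_, rfl⟩
      · intro x hx
        obtain ⟨t, ht, rfl⟩ := List.mem_map.1 hx
        exact hv _ (by omega) (by have := List.mem_range.1 ht; omega)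
      · simp
    have hw := hcut _ le_rfl hcs
    obtain ⟨w, hw1, hl1, hp1⟩ := hword s' q fun t h1 h2 => hw t (by omega) (by omega)
    obtain ⟨w', hw2, hl2, hp2⟩ := hword (s' + q) q fun t h1 h2 => hw t (by omega) (by omega)
    have hper : segment c (s' + q + (q + N')) q = segment c s' q := by
      rw [← segment_add_period hc s' q]; congr 1; omega
    have hcyc : segment c (s' + q) (2 * q + N') =
        segment c (s' + q) q * segment c (s' + q + q) N' * segment c s' q := by
      rw [show 2 * q + N' = q + N' + q by omega, segment_add, segment_add, ← hper]
    rw [hcyc, Matrix.trace_mul_comm _ P, ← mul_assoc P P, h.idem, ← trace_segment_eq hc s',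
      show 2 * q + N' = q + (q + N') by omega, segment_add, segment_add, ← mul_assoc, hp1, hp2,
      h.insert w w' hw1 hw2 hl1.ge hl2.ge, mul_assoc, mul_assoc, Matrix.trace_mul_comm]
    simp only [mul_assoc]
  have h2 := cutChain_mul_segment h hcut N N le_rfl
  rw [h1, ← h2, Nat.sub_self, segment_zero, one_mul]
  obtain ⟨N', rfl⟩ := Nat.exists_eq_succ_of_ne_zero hN0.ne'
  rw [cutChain, if_pos (by rwa [add_assoc]), mul_assoc, h.idem]

lemma mul_cutChain {P : Matrix n n ℂ} (hP : P * P = P) (cut : ℕ → Prop) (c : ℕ → Matrix n n ℂ)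
    (s m : ℕ) : P * cutChain cut P c s m = cutChain cut P c s m := by
  induction m with
  | zero => exact hP
  | succ m ih => rw [cutChain, ← mul_assoc, ← mul_assoc, ih]

/-- If the letters of `c` are split among the families `a` and `b`, with cuts separating the two
kinds, then the ring traces multiply. -/
lemma trace_cutChain_factor {P E : Matrix n n ℂ} (hP : P * P = P) (hPt : P.trace = 1)
    (hPE : P * E = P) {cut nA nB : ℕ → Prop} {a b c : ℕ → Matrix n n ℂ} {δ : ℕ → ℂ}
    {s : ℕ} (hdisj : ∀ k, s ≤ k → nA k → ¬ nB k)
    (hcut : ∀ k, s ≤ k → ¬ cut (k + 1) → (nA k ∧ nA (k + 1)) ∨ (nB k ∧ nB (k + 1)))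
    (hs : cut s)
    (haA : ∀ k, s ≤ k → nA k → a k = c k) (haE : ∀ k, s ≤ k → ¬ nA k → a k = E)
    (hbB : ∀ k, s ≤ k → nB k → b k = c k) (hbE : ∀ k, s ≤ k → ¬ nB k → b k = E)
    (hδ : ∀ k, s ≤ k → nA k ∨ nB k → δ k = 1)
    (hvac : ∀ k, s ≤ k → ¬ nA k → ¬ nB k → P * c k * P = δ k • P) {N : ℕ} (hN : cut (s + N)) :
    (cutChain cut P c s N).trace =
      (segment δ s N) * (cutChain cut P a s N).trace * (cutChain cut P b s N).trace := by
  set A := cutChain cut P a s with hA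
  set B := cutChain cut P b s with hB
  set C := cutChain cut P c s with hC
  have hPX : ∀ X, P * X * P = (P * X).trace • P := fun X => mul_mul_eq_trace_smul hP hPt X
  -- At a cut the chain begins and ends with `P`, so it is a multiple of `P`.
  have hend : ∀ m, cut (s + m) → ∃ γ : ℂ, C m = γ • P := by
    intro m hm
    cases m with
    | zero => exact ⟨1, by rw [one_smul]; rfl⟩
    | succ m =>
      refine ⟨(P * (C m * c (s + m))).trace, ?_⟩
      rw [← hPX, ← mul_assoc, hC, mul_cutChain hP, cutChain, if_pos (by rwa [add_assoc])]
  -- The chain `C` is carried by the first tensor slot away from the `B` family and by the second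
  -- away from the `A` family, while the idle slot holds `P`, stable under `E`. At a cut `C m` is a
  -- multiple of `P`, so both descriptions agree and `C` can change slots.
  have key : ∀ m, (¬ nB (s + m) ∨ cut (s + m) →
        segment δ s m • (A m ⊗ₖ B m) = C m ⊗ₖ P) ∧
      (¬ nA (s + m) ∨ cut (s + m) → segment δ s m • (A m ⊗ₖ B m) = P ⊗ₖ C m) := by
    intro m
    induction m with
    | zero => simp [hA, hB, hC, cutChain]
    | succ m ih =>
      set X : Matrix n n ℂ := open Classical in if cut (s + m + 1) then P else 1 with hX
      have hA' : A (m + 1) = A m * a (s + m) * X := rfl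
      have hB' : B (m + 1) = B m * b (s + m) * X := rfl
      have hC' : C (m + 1) = C m * c (s + m) * X := rfl
      have hseg : segment δ s (m + 1) = δ (s + m) * segment δ s m := by
        rw [segment_succ, mul_comm]
      have hstep : segment δ s (m + 1) • (A (m + 1) ⊗ₖ B (m + 1)) =
          δ (s + m) • ((segment δ s m • (A m ⊗ₖ B m)) * (a (s + m) ⊗ₖ b (s + m)) * (X ⊗ₖ X)) := by
        rw [hA', hB', hseg, Matrix.smul_mul, Matrix.smul_mul, smul_smul, ← Matrix.mul_kronecker_mul,
          ← Matrix.mul_kronecker_mul]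
      by_cases hc : cut (s + m + 1)
      · have hXP : X = P := by simp [hX, hc]
        obtain ⟨γ, hγ⟩ := hend (m + 1) (by rwa [← add_assoc])
        have hboth : C (m + 1) ⊗ₖ P = P ⊗ₖ C (m + 1) := by
          rw [hγ, Matrix.smul_kronecker, Matrix.kronecker_smul]
        have hgoal : segment δ s (m + 1) • (A (m + 1) ⊗ₖ B (m + 1)) = C (m + 1) ⊗ₖ P := by
          by_cases hnB : nB (s + m)
          · have hnA : ¬ nA (s + m) := fun h => hdisj _ (by omega) h hnB
            rw [hboth, hstep, ih.2 (Or.inl hnA), haE _ (by omega) hnA, hbB _ (by omega) hnB,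
              hδ _ (by omega) (Or.inr hnB), one_smul, ← Matrix.mul_kronecker_mul,
              ← Matrix.mul_kronecker_mul, hPE, hC', hXP, hP]
          · rw [hstep, ih.1 (Or.inl hnB), hbE _ (by omega) hnB]
            by_cases hnA : nA (s + m)
            · rw [haA _ (by omega) hnA, hδ _ (by omega) (Or.inl hnA), one_smul,
                ← Matrix.mul_kronecker_mul, ← Matrix.mul_kronecker_mul, hPE, hC', hXP, hP]
            -- A letter in neither family has cuts on both sides, so only its compression `P * c * P
            -- = δ • P` enters.
            · have hcm : cut (s + m) := by
                by_contra hcm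
                cases m with
                | zero => exact hcm hs
                | succ m =>
                  rcases hcut (s + m) (by omega) hcm with h | h
                  · exact hnA h.2
                  · exact hnB h.2
              obtain ⟨γ', hγ'⟩ := hend m hcm
              rw [haE _ (by omega) hnA, ← Matrix.mul_kronecker_mul, ← Matrix.mul_kronecker_mul, hPE,
                hC', hXP, hP, hγ', Matrix.smul_mul, Matrix.smul_mul, Matrix.smul_mul, Matrix.smul_mul,
                hvac _ (by omega) hnA hnB, hPE, hP, ← Matrix.smul_kronecker, smul_comm]
        exact ⟨fun _ => hgoal, fun _ => hgoal.trans hboth⟩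
      · have hX1 : X = 1 := by simp [hX, hc]
        rw [← add_assoc]
        rcases hcut (s + m) (by omega) hc with ⟨h1, h2⟩ | ⟨h1, h2⟩
        · refine ⟨fun _ => ?_, fun h => absurd h2 (by tauto)⟩
          have hnB := hdisj _ (by omega) h1
          rw [hstep, ih.1 (Or.inl hnB), hbE _ (by omega) hnB, haA _ (by omega) h1,
            hδ _ (by omega) (Or.inl h1), one_smul, ← Matrix.mul_kronecker_mul,
            ← Matrix.mul_kronecker_mul, hPE, hC', hX1, mul_one, mul_one]
        · have hnA : ¬ nA (s + m) := fun h => hdisj _ (by omega) h h1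
          refine ⟨fun h => absurd h2 (by tauto), fun _ => ?_⟩
          rw [hstep, ih.2 (Or.inl hnA), haE _ (by omega) hnA, hbB _ (by omega) h1,
            hδ _ (by omega) (Or.inr h1), one_smul, ← Matrix.mul_kronecker_mul,
            ← Matrix.mul_kronecker_mul, hPE, hC', hX1, mul_one, mul_one]
  have := congrArg Matrix.trace ((key N).1 (Or.inr hN))
  rw [Matrix.trace_smul, Matrix.trace_kronecker, Matrix.trace_kronecker, hPt, mul_one,
    smul_eq_mul] at this
  rw [← this, mul_assoc]

end Ring

/-! ### Double-layer transfer matrices -/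

section Transfer

open scoped Kronecker

variable {S I : Type} {D : ℕ}

/-- The local weight of the identity. -/
def diagWeight (S : Type) [DecidableEq S] : S → S → ℂ := fun s t => if s = t then 1 else 0

lemma prod_diagWeight {S : Type} [DecidableEq S] {ι : Type*} [Fintype ι] (f g : ι → S) :
    ∏ k, diagWeight S (f k) (g k) = if f = g then 1 else 0 := by
  by_cases h : f = g
  · simp [h, diagWeight]
  · obtain ⟨k, hk⟩ := Function.ne_iff.1 h
    rw [if_neg h]
    exact Finset.prod_eq_zero (Finset.mem_univ k) (by simp [diagWeight, hk])

/-- The transfer matrix of the bra tensor `A` and the ket tensor `B`, with the physical outputs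
contracted with the weight `w`. -/
noncomputable def transfer [Fintype S] (A B : S → I → Matrix (Fin D) (Fin D) ℂ) (w : S → S → ℂ)
    (i j : I) : Matrix (Fin D × Fin D) (Fin D × Fin D) ℂ :=
  ∑ p : S × S, w p.1 p.2 • ((A p.2 j).map star ⊗ₖ B p.1 i)

lemma prod_ofFn_kronecker {N : ℕ} (X Y : Fin N → Matrix (Fin D) (Fin D) ℂ) :
    (List.ofFn fun k => (X k).map star ⊗ₖ Y k).prod =
      ((List.ofFn X).prod).map star ⊗ₖ (List.ofFn Y).prod := by
  induction N with
  | zero =>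
    simp only [List.ofFn_zero, List.prod_nil]
    rw [Matrix.map_one _ (star_zero _) (star_one _), Matrix.one_kronecker_one]
  | succ N ih =>
    rw [List.ofFn_succ, List.ofFn_succ, List.ofFn_succ, List.prod_cons, List.prod_cons,
      List.prod_cons, ih, ← Matrix.mul_kronecker_mul]
    congr 1
    exact (Matrix.map_mul (f := starRingEnd ℂ)).symm

lemma sum_prod_ofFn {R : Type*} [Semiring R] [Algebra ℂ R] {N : ℕ} {α : Type*} [Fintype α]
    (g : Fin N → α → R) :
    (List.ofFn fun k => ∑ a, g k a).prod = ∑ f : Fin N → α, (List.ofFn fun k => g k (f k)).prod := by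
  classical
  have := (MultilinearMap.mkPiAlgebraFin ℂ N R).map_sum g
  simpa only [MultilinearMap.mkPiAlgebraFin_apply] using this

lemma smul_prod_ofFn {R : Type*} [Semiring R] [Algebra ℂ R] {N : ℕ} (c : Fin N → ℂ) (m : Fin N → R) :
    (List.ofFn fun k => c k • m k).prod = (∏ k, c k) • (List.ofFn m).prod := by
  have := (MultilinearMap.mkPiAlgebraFin ℂ N R).map_smul_univ c m
  simpa only [MultilinearMap.mkPiAlgebraFin_apply] using this

lemma prod_ofFn_transfer [Fintype S] {N : ℕ} (A B : Fin N → S → I → Matrix (Fin D) (Fin D) ℂ)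
    (w : Fin N → S → S → ℂ) (i j : Fin N → I) :
    (List.ofFn fun k => transfer (A k) (B k) (w k) (i k) (j k)).prod =
      ∑ s : Fin N → S, ∑ t : Fin N → S, (∏ k, w k (s k) (t k)) •
        (((List.ofFn fun k => A k (t k) (j k)).prod).map star ⊗ₖ
          (List.ofFn fun k => B k (s k) (i k)).prod) := by
  unfold transfer
  rw [sum_prod_ofFn, ← Fintype.sum_prod_type',
    ← (Equiv.arrowProdEquivProdArrow (Fin N) (fun _ => S) (fun _ => S)).sum_comp]
  refine Finset.sum_congr rfl fun p _ => ?_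
  rw [smul_prod_ofFn, prod_ofFn_kronecker]
  rfl

/-- Expectation of a product weight, as the trace of a product of transfer matrices. -/
lemma sum_prod_mul_trace [Fintype S] {N : ℕ} (A B : Fin N → S → I → Matrix (Fin D) (Fin D) ℂ)
    (w : Fin N → S → S → ℂ) (i j : Fin N → I) :
    ∑ s : Fin N → S, ∑ t : Fin N → S, (∏ k, w k (s k) (t k)) *
        (star (List.ofFn fun k => A k (t k) (j k)).prod.trace *
          (List.ofFn fun k => B k (s k) (i k)).prod.trace) =
      (List.ofFn fun k => transfer (A k) (B k) (w k) (i k) (j k)).prod.trace := by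
  rw [prod_ofFn_transfer, Matrix.trace_sum]
  refine Finset.sum_congr rfl fun s _ => ?_
  rw [Matrix.trace_sum]
  refine Finset.sum_congr rfl fun t _ => ?_
  rw [Matrix.trace_smul, Matrix.trace_kronecker, smul_eq_mul]
  congr 2
  simp [Matrix.trace]

lemma sum_diagWeight [Fintype S] [DecidableEq S] {N : ℕ} (f : (Fin N → S) → (Fin N → S) → ℂ) :
    ∑ s : Fin N → S, ∑ t : Fin N → S, (∏ k, diagWeight S (s k) (t k)) * f s t = ∑ s, f s s := by
  refine Finset.sum_congr rfl fun s _ => ?_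
  simp [prod_diagWeight]

/-- The tensor with both output indices merged. -/
def Tensor.merged {O P : Type} (V : Tensor O P I D) : O × P → I → Matrix (Fin D) (Fin D) ℂ :=
  fun s => V s.1 s.2

/-- The transfer matrix of `V† V`. -/
noncomputable def Tensor.normTransfer {O P : Type} [Fintype O] [Fintype P] [DecidableEq O]
    [DecidableEq P] (V : Tensor O P I D) (x : I × I) : Matrix (Fin D × Fin D) (Fin D × Fin D) ℂ :=
  transfer V.merged V.merged (diagWeight (O × P)) x.1 x.2

/-- All closed words in the matrices `T` evaluate to products of deltas. -/
def TraceDelta {n : Type*} [Fintype n] [DecidableEq n] [DecidableEq I]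
    (T : I × I → Matrix n n ℂ) : Prop :=
  ∀ w : List (I × I), w ≠ [] →
    (w.map T).prod.trace = (w.map fun x => diagWeight I x.1 x.2).prod

variable {O P : Type} [Fintype O] [Fintype P] [DecidableEq O] [DecidableEq P] [DecidableEq I]

omit [DecidableEq I] in
lemma Tensor.conjTranspose_mul_self_apply (V : Tensor O P I D) (N : ℕ) (i j : Fin N → I) :
    ((V.mpo N)ᴴ * V.mpo N) j i = (List.ofFn fun k => V.normTransfer (i k, j k)).prod.trace := by
  unfold Tensor.normTransfer
  rw [← sum_prod_mul_trace (fun _ => V.merged) (fun _ => V.merged) (fun _ => diagWeight _),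
    sum_diagWeight]
  rfl

/-- A word of length `N` is an entry of `V_N† V_N` on the ring of `N` sites, its letters being the
pairs of ket and bra inputs. Having the isometry for every `N` is what controls words of every
length. -/
lemma Tensor.IsHMPI.traceDelta {V : Tensor O P I D} (hV : V.IsHMPI) :
    TraceDelta V.normTransfer := by
  intro w hw
  have h1 := congrFun (congrFun (hV w.length (List.length_pos_iff.2 hw))
    (fun k => (w.get k).2)) (fun k => (w.get k).1)
  rw [V.conjTranspose_mul_self_apply] at h1
  have h2 : (List.ofFn fun k : Fin w.length => V.normTransfer ((w.get k).1, (w.get k).2)) =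
      w.map V.normTransfer := by
    rw [← List.ofFn_get (w.map V.normTransfer)]
    simp [List.ofFn_eq_map]
  have h3 : (w.map fun x => diagWeight I x.1 x.2).prod =
      ∏ k : Fin w.length, diagWeight I (w.get k).1 (w.get k).2 := by
    rw [← List.prod_ofFn]
    congr 1
    rw [← List.ofFn_get (w.map _)]
    simp [List.ofFn_eq_map]
  rw [← h2, h1, h3, prod_diagWeight (fun k => (w.get k).1), Matrix.one_apply]
  simp only [eq_comm]

omit [Fintype O] [Fintype P] [DecidableEq O] [DecidableEq P] [DecidableEq I] in
lemma transfer_diagWeight [Fintype S] [DecidableEq S] (A B : S → I → Matrix (Fin D) (Fin D) ℂ)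
    (i j : I) :
    transfer A B (diagWeight S) i j = ∑ s, (A s j).map star ⊗ₖ B s i := by
  rw [transfer, Fintype.sum_prod_type]
  refine Finset.sum_congr rfl fun s _ => ?_
  simp [diagWeight, ite_smul]

omit [DecidableEq I] in
lemma Tensor.normTransfer_blocked (V : Tensor O P I D) (q : ℕ) (x : (Fin q → I) × (Fin q → I)) :
    (V.blocked q).normTransfer x =
      (List.ofFn fun k => V.normTransfer (x.1 k, x.2 k)).prod := by
  unfold Tensor.normTransfer
  rw [transfer_diagWeight]
  simp only [transfer_diagWeight]
  rw [sum_prod_ofFn,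
    ← (Equiv.arrowProdEquivProdArrow (Fin q) (fun _ => O) (fun _ => P)).sum_comp]
  refine Finset.sum_congr rfl fun s _ => ?_
  rw [prod_ofFn_kronecker]
  rfl

/-- A word in blocked letters flattens to a word in the original ones, nonempty because `0 < q`. -/
lemma Tensor.traceDelta_blocked {V : Tensor O P I D} (h : TraceDelta V.normTransfer) {q : ℕ}
    (hq : 0 < q) : TraceDelta (V.blocked q).normTransfer := by
  intro w hw
  let flat : (Fin q → I) × (Fin q → I) → List (I × I) := fun x => List.ofFn fun k => (x.1 k, x.2 k)
  have h1 : (w.map (V.blocked q).normTransfer).prod =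
      ((w.flatMap flat).map V.normTransfer).prod := by
    clear hw
    induction w with
    | nil => simp
    | cons x w ih =>
      rw [List.map_cons, List.prod_cons, ih, V.normTransfer_blocked, List.flatMap_cons,
        List.map_append, List.prod_append, List.map_ofFn]
      rfl
  have h2 : (w.map fun x => diagWeight (Fin q → I) x.1 x.2).prod =
      ((w.flatMap flat).map fun x => diagWeight I x.1 x.2).prod := by
    clear hw h1
    induction w with
    | nil => simp
    | cons x w ih =>
      rw [List.map_cons, List.prod_cons, ih, List.flatMap_cons,
        List.map_append, List.prod_append, List.map_ofFn, List.prod_ofFn]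
      congr 1
      simp only [Function.comp_def, prod_diagWeight x.1 x.2]
      rfl
  rw [h1, h2]
  refine h _ ?_
  obtain ⟨x, w, rfl⟩ := List.exists_cons_of_ne_nil hw
  simp only [List.flatMap_cons, ne_eq, List.append_eq_nil_iff, not_and]
  intro h
  exact absurd (congrArg List.length h) (by simp [flat, hq.ne'])

/-- Long words in the transfer matrices can be cut in two by the `q`-th power of the vacuum transfer
matrix. -/
structure Tensor.IsSimple (V : Tensor O P I D) (i₀ : I) (q : ℕ) : Prop where
  pos : 0 < q
  traceDelta : TraceDelta V.normTransfer
  absorb : V.normTransfer (i₀, i₀) * V.normTransfer (i₀, i₀) ^ q = V.normTransfer (i₀, i₀) ^ q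
  absorbs : Absorbs (Set.range V.normTransfer) (V.normTransfer (i₀, i₀) ^ q) q

omit [DecidableEq I] in
lemma exists_map_eq_of_forall_mem_range {κ R : Type*} (T : κ → R) (w : List R)
    (hw : ∀ x ∈ w, x ∈ Set.range T) : ∃ u : List κ, u.map T = w := by
  have : w ∈ Set.range (List.map T) := by rw [Set.range_list_map]; exact hw
  exact this

lemma TraceDelta.trace_pow {n : Type*} [Fintype n] [DecidableEq n] {T : I × I → Matrix n n ℂ}
    (h : TraceDelta T) (i₀ : I) (k : ℕ) : (T (i₀, i₀) ^ (k + 1)).trace = 1 := by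
  have := h (List.replicate (k + 1) (i₀, i₀)) (by simp)
  simpa [diagWeight] using this

/-- After at most `D ^ 2` sites, a tensor that generates isometries is simple. -/
lemma Tensor.IsHMPI.isSimple {V : Tensor O P I D} (hV : V.IsHMPI) (hD : 0 < D) (i₀ : I) :
    V.IsSimple i₀ (D * D) := by
  have hT := hV.traceDelta
  have hcard : Fintype.card (Fin D × Fin D) = D * D := by simp
  obtain ⟨hid, habs⟩ := isIdempotentElem_pow_card (hT.trace_pow i₀)
  rw [hcard] at hid habs
  refine ⟨by positivity, hT, habs, hid, ⟨List.replicate (D * D) (V.normTransfer (i₀, i₀)), ?_⟩, ?_⟩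
  · simp
  · intro w w' hw hw' hl hl'
    obtain ⟨u, rfl⟩ := exists_map_eq_of_forall_mem_range _ w hw
    obtain ⟨u', rfl⟩ := exists_map_eq_of_forall_mem_range _ w' hw'
    have := prod_mul_prod_eq_of_trace (T := V.normTransfer)
      (δ := fun x => diagWeight I x.1 x.2) (i₀, i₀)
      (by simp [diagWeight]) hT u u' (by rw [hcard]; simpa using hl) (by rw [hcard]; simpa using hl')
    rwa [hcard] at this

/-- Blocking as many sites as needed makes the tensor simple at length one. -/
lemma Tensor.IsSimple.blocked {V : Tensor O P I D} {i₀ : I} {q : ℕ} (h : V.IsSimple i₀ q) :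
    (V.blocked q).IsSimple (fun _ => i₀) 1 := by
  have hE : (V.blocked q).normTransfer (fun _ => i₀, fun _ => i₀) =
      V.normTransfer (i₀, i₀) ^ q := by
    rw [V.normTransfer_blocked]; simp
  have hword : ∀ w : List (Matrix (Fin D × Fin D) (Fin D × Fin D) ℂ),
      (∀ x ∈ w, x ∈ Set.range (V.blocked q).normTransfer) → 1 ≤ w.length →
      ∃ u : List (Matrix (Fin D × Fin D) (Fin D × Fin D) ℂ),
        (∀ x ∈ u, x ∈ Set.range V.normTransfer) ∧ q ≤ u.length ∧ u.prod = w.prod := by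
    intro w hw hl
    obtain ⟨w', rfl⟩ := exists_map_eq_of_forall_mem_range _ w hw
    refine ⟨w'.flatMap fun x => List.ofFn fun k => V.normTransfer (x.1 k, x.2 k), ?_, ?_, ?_⟩
    · intro x hx
      obtain ⟨y, -, hy⟩ := List.mem_flatMap.1 hx
      obtain ⟨k, rfl⟩ := (List.mem_ofFn' _ _).1 hy
      exact ⟨_, rfl⟩
    · obtain ⟨y, w', rfl⟩ := List.exists_cons_of_ne_nil (l := w') (by rintro rfl; simp at hl)
      simp
    · clear hw hl
      induction w' with
      | nil => simp
      | cons y w' ih => simp [ih, V.normTransfer_blocked]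
  refine ⟨one_pos, Tensor.traceDelta_blocked h.traceDelta h.pos, ?_, ?_, ?_, ?_⟩
  · rw [pow_one, hE, h.absorbs.idem]
  · rw [pow_one, hE, h.absorbs.idem]
  · exact ⟨[(V.blocked q).normTransfer (fun _ => i₀, fun _ => i₀)], by simp, by simp, by simp⟩
  · intro w w' hw hw' hl hl'
    obtain ⟨u, hu, hul, hup⟩ := hword w hw hl
    obtain ⟨u', hu', hul', hup'⟩ := hword w' hw' hl'
    rw [pow_one, hE, ← hup, ← hup', h.absorbs.insert u u' hu hu' hul hul']

end Transfer

/-! ### Reduced states as expectation values -/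

section Expectation

variable {S : Type} {N : ℕ}

lemma glue_of_mem {A : Finset (Fin N)} (x : A → S) (e : (Aᶜ : Finset (Fin N)) → S) {k : Fin N}
    (h : k ∈ A) : glue A x e k = x ⟨k, h⟩ := by simp [glue, h]

lemma glue_of_notMem {A : Finset (Fin N)} (x : A → S) (e : (Aᶜ : Finset (Fin N)) → S) {k : Fin N}
    (h : k ∉ A) : glue A x e k = e ⟨k, Finset.mem_compl.2 h⟩ := by simp [glue, h]

/-- Configurations are pairs of configurations on a region and on its complement. -/
def glueEquiv (S : Type) {N : ℕ} (A : Finset (Fin N)) :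
    (A → S) × ((Aᶜ : Finset (Fin N)) → S) ≃ (Fin N → S) where
  toFun p := glue A p.1 p.2
  invFun s := (fun k => s k, fun k => s k)
  left_inv p := by
    ext k
    · exact glue_of_mem _ _ k.2
    · exact glue_of_notMem _ _ (Finset.mem_compl.1 k.2)
  right_inv s := by
    ext k
    by_cases h : k ∈ A
    · exact glue_of_mem _ _ h
    · exact glue_of_notMem _ _ h

open Classical in
/-- The indicator function of the pairs of configurations that agree outside `A`. -/
noncomputable def agreeOff (A : Finset (Fin N)) (s t : Fin N → S) : ℂ :=
  if ∀ k ∉ A, s k = t k then 1 else 0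

lemma agreeOff_glue (A : Finset (Fin N)) (x y : A → S) (e e' : (Aᶜ : Finset (Fin N)) → S)
    [DecidableEq ((Aᶜ : Finset (Fin N)) → S)] :
    agreeOff A (glue A x e) (glue A y e') = if e = e' then 1 else 0 := by
  unfold agreeOff
  congr 1
  rw [eq_iff_iff]
  constructor
  · intro h
    ext k
    have := h k (Finset.mem_compl.1 k.2)
    rwa [glue_of_notMem _ _ (Finset.mem_compl.1 k.2), glue_of_notMem _ _ (Finset.mem_compl.1 k.2)]
      at this
  · rintro rfl k hk
    rw [glue_of_notMem _ _ hk, glue_of_notMem _ _ hk]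

/-- Expectation values of operators supported on `A` only depend on the reduced state on `A`. -/
lemma sum_agreeOff_mul [Fintype S] (ρ : Matrix (Fin N → S) (Fin N → S) ℂ) (A : Finset (Fin N))
    (f : (A → S) → (A → S) → ℂ) :
    ∑ s, ∑ t, agreeOff A s t * f (fun k => s k) (fun k => t k) * ρ s t =
      ∑ x, ∑ y, f x y * reducedState ρ A x y := by
  classical
  have hres : ∀ (x : A → S) (e : (Aᶜ : Finset (Fin N)) → S), (fun k : A => glue A x e k) = x :=
    fun x e => funext fun k => glue_of_mem _ _ k.2
  rw [← (glueEquiv S A).sum_comp, Fintype.sum_prod_type]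
  refine Finset.sum_congr rfl fun x _ => ?_
  simp only [← (glueEquiv S A).sum_comp (fun t => _ * _ * ρ _ t), Fintype.sum_prod_type]
  rw [Finset.sum_comm]
  refine Finset.sum_congr rfl fun y _ => ?_
  change _ = f x y * ∑ e, ρ (glue A x e) (glue A y e)
  rw [Finset.mul_sum]
  refine Finset.sum_congr rfl fun e _ => ?_
  simp [glueEquiv, agreeOff_glue, hres]

/-- The local weights whose expectation value is a matrix element of the reduced state on `A`. -/
noncomputable def regionWeight [DecidableEq S] (A : Finset (Fin N)) (x y : A → S) (k : Fin N)
    (s t : S) : ℂ :=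
  if h : k ∈ A then diagWeight S s (x ⟨k, h⟩) * diagWeight S t (y ⟨k, h⟩) else diagWeight S s t

lemma prod_regionWeight [DecidableEq S] (A : Finset (Fin N)) (x y : A → S) (s t : Fin N → S) :
    ∏ k, regionWeight A x y k (s k) (t k) =
      agreeOff A s t * ((if (fun k : A => s k) = x then 1 else 0) *
        if (fun k : A => t k) = y then 1 else 0) := by
  rw [← Finset.prod_mul_prod_compl A, mul_comm]
  congr 1
  · rw [← Finset.prod_coe_sort]
    have h1 : ∀ k : (Aᶜ : Finset (Fin N)), regionWeight A x y k (s k) (t k) =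
        diagWeight S (s k) (t k) := fun k => by
      rw [regionWeight, dif_neg (Finset.mem_compl.1 k.2)]
    rw [Finset.prod_congr rfl fun k _ => h1 k,
      prod_diagWeight (fun k : (Aᶜ : Finset (Fin N)) => s k) fun k => t k]
    unfold agreeOff
    congr 1
    simp [funext_iff]
  · rw [← Finset.prod_coe_sort]
    have h1 : ∀ k : A, regionWeight A x y k (s k) (t k) =
        diagWeight S (s k) (x k) * diagWeight S (t k) (y k) := fun k => by
      rw [regionWeight, dif_pos k.2]
    rw [Finset.prod_congr rfl fun k _ => h1 k, Finset.prod_mul_distrib,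
      prod_diagWeight (fun k : A => s k), prod_diagWeight (fun k : A => t k)]

lemma reducedState_eq_sum [Fintype S] [DecidableEq S] (ρ : Matrix (Fin N → S) (Fin N → S) ℂ)
    (A : Finset (Fin N)) (x y : A → S) :
    reducedState ρ A x y = ∑ s, ∑ t, (∏ k, regionWeight A x y k (s k) (t k)) * ρ s t := by
  simp only [prod_regionWeight]
  rw [sum_agreeOff_mul ρ A fun x' y' => (if x' = x then 1 else 0) * if y' = y then 1 else 0]
  simp

lemma ringDist_self (k : Fin N) : ringDist k k = 0 := by simp [ringDist]

/-- Operators supported on distant regions are uncorrelated. -/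
lemma HasCorrelationRange.sum_mul [Fintype S] {ρ : Matrix (Fin N → S) (Fin N → S) ℂ} {ξ : ℕ}
    (h : HasCorrelationRange ρ ξ) {A B : Finset (Fin N)}
    (hAB : ∀ a ∈ A, ∀ b ∈ B, ξ < ringDist a b) (f : (A → S) → (A → S) → ℂ)
    (g : (B → S) → (B → S) → ℂ) :
    ∑ s, ∑ t, agreeOff (A ∪ B) s t * (f (fun k => s k) (fun k => t k) *
        g (fun k => s k) (fun k => t k)) * ρ s t =
      (∑ s, ∑ t, agreeOff A s t * f (fun k => s k) (fun k => t k) * ρ s t) *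
        ∑ s, ∑ t, agreeOff B s t * g (fun k => s k) (fun k => t k) * ρ s t := by
  have hd : Disjoint A B := by
    rw [Finset.disjoint_left]
    intro k hA hB
    have := hAB k hA k hB
    rw [ringDist_self] at this
    omega
  rw [sum_agreeOff_mul ρ A f, sum_agreeOff_mul ρ B g]
  have h1 := sum_agreeOff_mul ρ (A ∪ B) fun x y =>
    f (Finset.restrict₂ (π := fun _ => S) Finset.subset_union_left x)
        (Finset.restrict₂ (π := fun _ => S) Finset.subset_union_left y) *
      g (Finset.restrict₂ (π := fun _ => S) Finset.subset_union_right x)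
        (Finset.restrict₂ (π := fun _ => S) Finset.subset_union_right y)
  refine h1.trans ?_
  simp only [h A B hAB]
  let e := Equiv.piFinsetUnion (fun _ => S) hd
  have hl : ∀ p, Finset.restrict₂ (π := fun _ => S) Finset.subset_union_left (e p) = p.1 := fun p =>
    funext fun k => Equiv.piFinsetUnion_left (fun _ => S) hd k.2 _
  have hr : ∀ p, Finset.restrict₂ (π := fun _ => S) Finset.subset_union_right (e p) = p.2 :=
    fun p => funext fun k => Equiv.piFinsetUnion_right (fun _ => S) hd k.2 _
  rw [← e.sum_comp]
  simp only [← e.sum_comp (fun y => _ * (_ * _)), hl, hr, Fintype.sum_prod_type]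
  simp only [Finset.sum_mul_sum]
  refine Finset.sum_congr rfl fun x _ => Finset.sum_congr rfl fun x' _ =>
    Finset.sum_congr rfl fun y _ => Finset.sum_congr rfl fun y' _ => by ring

end Expectation

/-! ### Distances on the ring -/

section RingDist

variable {N : ℕ}

/-- Lifting to the integers with a winding number `z` turns the triangle inequality into that of
`ℤ`, with winding numbers adding up. -/
lemma ringDist_le_iff (i j : Fin N) (d : ℕ) :
    ringDist i j ≤ d ↔ ∃ z : ℤ, |(i : ℤ) - j + z * N| ≤ d := by
  have hi : (i : ℤ) < N := by exact_mod_cast i.2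
  have hj : (j : ℤ) < N := by exact_mod_cast j.2
  have hi0 : (0 : ℤ) ≤ i := by positivity
  have hj0 : (0 : ℤ) ≤ j := by positivity
  unfold ringDist
  constructor
  · intro h
    rcases min_le_iff.1 h with h | h
    · exact ⟨0, by rw [abs_le]; omega⟩
    · rcases le_total (j : ℤ) i with hij | hij
      · exact ⟨-1, by rw [abs_le]; omega⟩
      · exact ⟨1, by rw [abs_le]; omega⟩
  · rintro ⟨z, hz⟩
    rw [abs_le] at hz
    rcases lt_trichotomy z 0 with h | rfl | h
    · have : z * N ≤ -1 * N := by
        apply mul_le_mul_of_nonneg_right (by omega) (by omega)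
      rw [min_le_iff]; right; omega
    · rw [min_le_iff]; left; omega
    · have : 1 * (N : ℤ) ≤ z * N := by
        apply mul_le_mul_of_nonneg_right (by omega) (by omega)
      rw [min_le_iff]; right; omega

lemma ringDist_comm (i j : Fin N) : ringDist i j = ringDist j i := by
  unfold ringDist
  have : ((i : ℤ) - j).natAbs = ((j : ℤ) - i).natAbs := by omega
  rw [this]

lemma ringDist_triangle (i j k : Fin N) : ringDist i k ≤ ringDist i j + ringDist j k := by
  obtain ⟨z, hz⟩ := (ringDist_le_iff i j _).1 le_rfl
  obtain ⟨z', hz'⟩ := (ringDist_le_iff j k _).1 le_rfl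
  refine (ringDist_le_iff i k _).2 ⟨z + z', ?_⟩
  rw [show (i : ℤ) - k + (z + z') * N = ((i : ℤ) - j + z * N) + ((j : ℤ) - k + z' * N) by ring]
  push_cast
  exact (abs_add_le _ _).trans (add_le_add hz hz')

/-- The site of a ring of `N` sites with label `k` modulo `N`. -/
def ringSite (hN : 0 < N) (k : ℕ) : Fin N := ⟨k % N, Nat.mod_lt _ hN⟩

lemma ringSite_add (hN : 0 < N) (k : ℕ) : ringSite hN (k + N) = ringSite hN k := by
  simp [ringSite]

lemma ringSite_val (hN : 0 < N) (k : Fin N) : ringSite hN k = k := by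
  ext; simp [ringSite, Nat.mod_eq_of_lt k.2]

lemma ringDist_ringSite_le (hN : 0 < N) {k t d : ℕ} (h1 : k ≤ t + d) (h2 : t ≤ k + d) :
    ringDist (ringSite hN k) (ringSite hN t) ≤ d := by
  refine (ringDist_le_iff _ _ _).2 ⟨(k / N : ℕ) - (t / N : ℕ), ?_⟩
  have e1 : ((k % N : ℕ) : ℤ) = k - N * (k / N : ℕ) := by
    have := Nat.mod_add_div k N
    rw [eq_sub_iff_add_eq]; exact_mod_cast this
  have e2 : ((t % N : ℕ) : ℤ) = t - N * (t / N : ℕ) := by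
    have := Nat.mod_add_div t N
    rw [eq_sub_iff_add_eq]; exact_mod_cast this
  simp only [ringSite]
  rw [e1, e2, show (k : ℤ) - N * (k / N : ℕ) - (t - N * (t / N : ℕ)) +
    ((k / N : ℕ) - (t / N : ℕ)) * N = k - t by ring, abs_le]
  omega

/-- The sites at distance at most `q` from `A`. -/
def thicken (q : ℕ) (A : Finset (Fin N)) : Finset (Fin N) :=
  Finset.univ.filter fun k => ∃ a ∈ A, ringDist a k ≤ q

lemma mem_thicken {q : ℕ} {A : Finset (Fin N)} {k : Fin N} :
    k ∈ thicken q A ↔ ∃ a ∈ A, ringDist a k ≤ q := by simp [thicken]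

lemma subset_thicken (q : ℕ) (A : Finset (Fin N)) : A ⊆ thicken q A := fun k hk =>
  mem_thicken.2 ⟨k, hk, by rw [ringDist_self]; exact Nat.zero_le _⟩

/-- Thickening both regions by `q` costs at most `2 * q` of their distance, so the margin `4 * q` is
more than enough. -/
lemma lt_ringDist_of_mem_thicken {q ξ : ℕ} {A B : Finset (Fin N)}
    (h : ∀ a ∈ A, ∀ b ∈ B, ξ + 4 * q < ringDist a b) :
    ∀ a ∈ thicken q A, ∀ b ∈ thicken q B, ξ < ringDist a b := by
  intro a ha b hb
  obtain ⟨a', ha', haa⟩ := mem_thicken.1 ha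
  obtain ⟨b', hb', hbb⟩ := mem_thicken.1 hb
  have h1 := h a' ha' b' hb'
  have h2 := ringDist_triangle a' a b'
  have h3 := ringDist_triangle a b b'
  rw [ringDist_comm b b'] at h3
  omega

/-- The bond to the left of site `k` has no site of `C` among its `q` neighbours on either side. -/
def IsCut (hN : 0 < N) (q : ℕ) (C : Finset (Fin N)) (k : ℕ) : Prop :=
  ∀ t, k ≤ t + q → t < k + q → ringSite hN t ∉ C

/-- A site that spoils the bond lies within `q` of both endpoints of the bond, so the two endpoints
lie in the same neighbourhood. -/
lemma mem_thicken_of_not_isCut {hN : 0 < N} {q : ℕ} {A B : Finset (Fin N)} {k : ℕ}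
    (h : ¬ IsCut hN q (A ∪ B) (k + 1)) :
    (ringSite hN k ∈ thicken q A ∧ ringSite hN (k + 1) ∈ thicken q A) ∨
      (ringSite hN k ∈ thicken q B ∧ ringSite hN (k + 1) ∈ thicken q B) := by
  simp only [IsCut, not_forall, not_not, Finset.mem_union] at h
  obtain ⟨t, h1, h2, h3⟩ := h
  have d1 : ringDist (ringSite hN t) (ringSite hN k) ≤ q :=
    ringDist_ringSite_le hN (by omega) (by omega)
  have d2 : ringDist (ringSite hN t) (ringSite hN (k + 1)) ≤ q :=
    ringDist_ringSite_le hN (by omega) (by omega)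
  rcases h3 with h3 | h3
  · exact Or.inl ⟨mem_thicken.2 ⟨_, h3, d1⟩, mem_thicken.2 ⟨_, h3, d2⟩⟩
  · exact Or.inr ⟨mem_thicken.2 ⟨_, h3, d1⟩, mem_thicken.2 ⟨_, h3, d2⟩⟩

/-- Without a cut, a walk around the ring from a site of `A` never leaves the neighbourhood of `A`,
yet it arrives at `B`. The bound `q ≤ s` keeps labels to the left of the cut from being truncated at
zero. -/
lemma exists_isCut (hN : 0 < N) {q : ℕ} {A B : Finset (Fin N)}
    (hd : Disjoint (thicken q A) (thicken q B)) (hA : A.Nonempty) (hB : B.Nonempty) :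
    ∃ s, q ≤ s ∧ IsCut hN q (A ∪ B) s := by
  by_contra! hno
  obtain ⟨a, ha⟩ := hA
  obtain ⟨b, hb⟩ := hB
  rw [Finset.disjoint_left] at hd
  have hsite : ∀ (m : ℕ) (k : Fin N), ringSite hN (k + m * N) = k := by
    intro m k
    ext; simp [ringSite, Nat.mod_eq_of_lt k.2]
  -- The offset `q * N` changes no site but makes all labels at least `q`.
  have hall : ∀ m, ringSite hN (a + q * N + m) ∈ thicken q A := by
    intro m
    induction m with
    | zero => rw [add_zero, hsite]; exact subset_thicken q A ha
    | succ m ih =>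
      have hq : q ≤ q * N := Nat.le_mul_of_pos_right q hN
      rcases mem_thicken_of_not_isCut (hno (a + q * N + m + 1) (by omega)) with h | h
      · exact h.2
      · exact absurd h.1 (hd ih)
  have h1 := hall (b + N - a)
  have ha2 := a.2
  rw [show (a : ℕ) + q * N + (b + N - a) = b + (q + 1) * N by
    rw [add_mul]; omega, hsite] at h1
  exact hd h1 (subset_thicken q B hb)

lemma IsCut.mono {hN : 0 < N} {q : ℕ} {C C' : Finset (Fin N)} (h : C' ⊆ C) {k : ℕ}
    (hk : IsCut hN q C k) : IsCut hN q C' k := fun t h1 h2 h3 => hk t h1 h2 (h h3)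

lemma IsCut.add_period {hN : 0 < N} {q : ℕ} {C : Finset (Fin N)} {k : ℕ} (hq : q ≤ k)
    (hk : IsCut hN q C k) : IsCut hN q C (k + N) := by
  intro t h1 h2
  obtain ⟨t, rfl⟩ := Nat.exists_eq_add_of_le' (show N ≤ t by omega)
  rw [ringSite_add]
  exact hk t (by omega) (by omega)

end RingDist

/-! ### Spreading of correlations -/

section Spread

variable {O P I : Type} {D N : ℕ}

/-- The Heisenberg picture of the product of the local weights `w`. -/
noncomputable def Tensor.heisenberg [Fintype O] [Fintype P] (V : Tensor O P I D)
    (w : Fin N → O × P → O × P → ℂ) (i j : Fin N → I) : ℂ :=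
  (List.ofFn fun k => transfer V.merged V.merged (w k) (i k) (j k)).prod.trace

/-- The configuration that equals `i` on `A` and `i₀` elsewhere. -/
def extend (i₀ : I) (A : Finset (Fin N)) (i : A → I) : Fin N → I := glue A i fun _ => i₀

lemma extend_of_mem {i₀ : I} {A : Finset (Fin N)} (i : Fin N → I) {k : Fin N} (h : k ∈ A) :
    extend i₀ A (fun k => i k) k = i k := glue_of_mem _ _ h

lemma extend_of_notMem {i₀ : I} {A : Finset (Fin N)} (i : A → I) {k : Fin N} (h : k ∉ A) :
    extend i₀ A i k = i₀ := glue_of_notMem _ _ h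

variable [Fintype O] [Fintype P] [Fintype I]

/-- The duality `Tr [W V σ V†] = Tr [(V† W V) σ]`; the calculation only reorders the four sums. -/
lemma Tensor.sum_mul_dilatedOutput (V : Tensor O P I D) (w : Fin N → O × P → O × P → ℂ)
    (σ : Matrix (Fin N → I) (Fin N → I) ℂ) :
    ∑ s, ∑ t, (∏ k, w k (s k) (t k)) * V.dilatedOutput N σ s t =
      ∑ i, ∑ j, V.heisenberg w i j * σ i j := by
  have h1 : ∀ s t, V.dilatedOutput N σ s t =
      ∑ i, ∑ j, (star (V.mpo N t j) * V.mpo N s i) * σ i j := by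
    intro s t
    rw [Tensor.dilatedOutput, Matrix.mul_apply, Finset.sum_comm]
    refine Finset.sum_congr rfl fun j _ => ?_
    rw [Matrix.mul_apply, Finset.sum_mul]
    refine Finset.sum_congr rfl fun i _ => ?_
    rw [Matrix.conjTranspose_apply]
    ring
  have h2 : ∀ i j, V.heisenberg w i j = ∑ s, ∑ t, (∏ k, w k (s k) (t k)) *
      (star (V.mpo N t j) * V.mpo N s i) := fun i j =>
    (sum_prod_mul_trace (fun _ => V.merged) (fun _ => V.merged) w i j).symm
  simp only [h1, h2, Finset.mul_sum, Finset.sum_mul]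
  calc _ = ∑ s, ∑ i, ∑ t, ∑ j, (∏ k, w k (s k) (t k)) *
        (star (V.mpo N t j) * V.mpo N s i * σ i j) :=
        Finset.sum_congr rfl fun s _ => Finset.sum_comm
    _ = ∑ i, ∑ s, ∑ t, ∑ j, (∏ k, w k (s k) (t k)) *
        (star (V.mpo N t j) * V.mpo N s i * σ i j) := Finset.sum_comm
    _ = ∑ i, ∑ s, ∑ j, ∑ t, (∏ k, w k (s k) (t k)) *
        (star (V.mpo N t j) * V.mpo N s i * σ i j) :=
        Finset.sum_congr rfl fun i _ => Finset.sum_congr rfl fun s _ => Finset.sum_comm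
    _ = ∑ i, ∑ j, ∑ s, ∑ t, (∏ k, w k (s k) (t k)) *
        (star (V.mpo N t j) * V.mpo N s i * σ i j) :=
        Finset.sum_congr rfl fun i _ => Finset.sum_comm
    _ = _ := by simp only [mul_assoc]

variable [DecidableEq O] [DecidableEq P] [DecidableEq I]

omit [Fintype I] in
lemma Tensor.heisenberg_diagWeight {V : Tensor O P I D} (hV : TraceDelta V.normTransfer) (hN : 0 < N)
    (i j : Fin N → I) :
    V.heisenberg (fun _ => diagWeight (O × P)) i j = if i = j then 1 else 0 := by
  have := hV (List.ofFn fun k => (i k, j k)) (by simpa using hN.ne')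
  rw [List.map_ofFn, List.map_ofFn, List.prod_ofFn (f := _ ∘ _)] at this
  rw [← prod_diagWeight]
  exact this

omit [Fintype I] [Fintype O] [Fintype P] [DecidableEq O] [DecidableEq P] [DecidableEq I] in
lemma segment_ringSite {R : Type*} [Monoid R] (hN : 0 < N) (f : Fin N → R) :
    segment (fun k => f (ringSite hN k)) 0 N = (List.ofFn f).prod := by
  unfold segment
  congr 1
  apply List.ext_getElem
  · simp
  · intro k h1 h2
    have hk : k < N := by simpa using h1
    simp [← ringSite_val hN ⟨k, hk⟩]

omit [Fintype I] [Fintype O] [Fintype P] [DecidableEq O] [DecidableEq P] [DecidableEq I] in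
lemma segment_rotate {R : Type*} [CommMonoid R] {c : ℕ → R} (hc : ∀ k, c (k + N) = c k) (s : ℕ) :
    segment c s N = segment c 0 N := by
  induction s with
  | zero => rfl
  | succ s ih =>
    rw [← ih]
    cases N with
    | zero => simp
    | succ N =>
      rw [segment_succ' c s, segment_succ c (s + 1), mul_comm, ← hc s,
        show s + (N + 1) = s + 1 + N by omega]

omit [Fintype I] in
/-- The Heisenberg picture of a product of operators on distant regions `A` and `B` is a product of
operators on their neighbourhoods. -/
lemma Tensor.IsSimple.heisenberg_eq {V : Tensor O P I D} {i₀ : I} {q : ℕ} (hV : V.IsSimple i₀ q)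
    (hN : 0 < N) (hqN : 2 * q ≤ N) {A B : Finset (Fin N)}
    (hd : Disjoint (thicken q A) (thicken q B))
    (hex : ∃ s, q ≤ s ∧ IsCut hN q (A ∪ B) s) {w wA wB : Fin N → O × P → O × P → ℂ}
    (hwA : ∀ k ∈ A, w k = wA k) (hwB : ∀ k ∈ B, w k = wB k)
    (hw : ∀ k, k ∉ A → k ∉ B → w k = diagWeight _)
    (hA : ∀ k ∉ A, wA k = diagWeight _) (hB : ∀ k ∉ B, wB k = diagWeight _) (i j : Fin N → I) :
    V.heisenberg w i j = agreeOff (thicken q A ∪ thicken q B) i j *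
      (V.heisenberg wA (extend i₀ (thicken q A) fun k => i k)
          (extend i₀ (thicken q A) fun k => j k) *
        V.heisenberg wB (extend i₀ (thicken q B) fun k => i k)
          (extend i₀ (thicken q B) fun k => j k)) := by
  obtain ⟨s, hs, hcut⟩ := hex
  have hcut' := hcut.add_period hs
  rw [Finset.disjoint_left] at hd
  let letter : (Fin N → O × P → O × P → ℂ) → (Fin N → I) → (Fin N → I) → ℕ →
      Matrix (Fin D × Fin D) (Fin D × Fin D) ℂ := fun w i j k =>
    transfer V.merged V.merged (w (ringSite hN k)) (i (ringSite hN k)) (j (ringSite hN k))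
  have hper : ∀ w i j k, letter w i j (k + N) = letter w i j k := by
    intro w i j k; simp only [letter, ringSite_add]
  have hdiag : ∀ w i j k, w (ringSite hN k) = diagWeight _ → letter w i j k =
      V.normTransfer (i (ringSite hN k), j (ringSite hN k)) := by
    intro w i j k h; simp only [letter, h]; rfl
  have htrace : ∀ w i j, (∀ k, k ∉ A → k ∉ B → w k = diagWeight _) → V.heisenberg w i j =
      (cutChain (IsCut hN q (A ∪ B)) (V.normTransfer (i₀, i₀) ^ q) (letter w i j) s N).trace := by
    intro w i j hw
    have h1 : V.heisenberg w i j = (segment (letter w i j) 0 N).trace := by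
      unfold Tensor.heisenberg
      rw [← segment_ringSite hN]
    rw [h1]
    refine trace_segment_eq_trace_cutChain hV.absorbs ?_ (hper w i j) hs hqN hN hcut hcut'
    intro k _ hk t h1 h2
    have hk := hk t h1 h2
    rw [Finset.mem_union, not_or] at hk
    exact ⟨_, (hdiag w i j t (hw _ hk.1 hk.2)).symm⟩
  obtain ⟨q', hq'⟩ := Nat.exists_eq_succ_of_ne_zero hV.pos.ne'
  have htr : (V.normTransfer (i₀, i₀) ^ q).trace = 1 := by
    rw [hq']; exact hV.traceDelta.trace_pow i₀ q'
  have hPE : V.normTransfer (i₀, i₀) ^ q * V.normTransfer (i₀, i₀) =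
      V.normTransfer (i₀, i₀) ^ q := by
    rw [← pow_succ, pow_succ', hV.absorb]
  have hAd : ∀ k, k ∉ thicken q A → k ∉ A := fun k hk h => hk (subset_thicken q A h)
  have hBd : ∀ k, k ∉ thicken q B → k ∉ B := fun k hk h => hk (subset_thicken q B h)
  -- Outside both neighbourhoods the Heisenberg observable acts as the identity, giving one delta
  -- per site; around the ring these multiply to `agreeOff`.
  let δ : Fin N → ℂ := fun k =>
    if k ∈ thicken q A ∪ thicken q B then 1 else diagWeight I (i k) (j k)
  have hfac := trace_cutChain_factor (E := V.normTransfer (i₀, i₀)) hV.absorbs.idem htr hPE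
    (cut := IsCut hN q (A ∪ B)) (nA := fun k => ringSite hN k ∈ thicken q A)
    (nB := fun k => ringSite hN k ∈ thicken q B)
    (a := letter wA (extend i₀ (thicken q A) fun k => i k) (extend i₀ (thicken q A) fun k => j k))
    (b := letter wB (extend i₀ (thicken q B) fun k => i k) (extend i₀ (thicken q B) fun k => j k))
    (c := letter w i j) (δ := fun k => δ (ringSite hN k)) (s := s)
    (fun k _ h => hd h) (fun k _ h => mem_thicken_of_not_isCut h) hcut
    (fun k _ h => by
      have hw' : wA (ringSite hN k) = w (ringSite hN k) := by
        by_cases hk : ringSite hN k ∈ A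
        · exact (hwA _ hk).symm
        · rw [hA _ hk, hw _ hk (hBd _ (hd h))]
      simp only [letter, extend_of_mem _ h, hw'])
    (fun k _ h => by
      rw [hdiag _ _ _ _ (hA _ (hAd _ h)), extend_of_notMem _ h, extend_of_notMem _ h])
    (fun k _ h => by
      have hnA : ringSite hN k ∉ thicken q A := fun h' => hd h' h
      have hw' : wB (ringSite hN k) = w (ringSite hN k) := by
        by_cases hk : ringSite hN k ∈ B
        · exact (hwB _ hk).symm
        · rw [hB _ hk, hw _ (hAd _ hnA) hk]
      simp only [letter, extend_of_mem _ h, hw'])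
    (fun k _ h => by
      rw [hdiag _ _ _ _ (hB _ (hBd _ h)), extend_of_notMem _ h, extend_of_notMem _ h])
    (fun k _ h => if_pos (Finset.mem_union.2 h))
    (fun k _ h h' => by
      rw [mul_mul_eq_trace_smul hV.absorbs.idem htr, hdiag _ _ _ _ (hw _ (hAd _ h) (hBd _ h'))]
      congr 1
      -- The scalar `tr (P * T x)` is itself the trace of a closed word, `q` vacuum letters followed
      -- by `x`.
      have := hV.traceDelta (List.replicate q (i₀, i₀) ++
        [(i (ringSite hN k), j (ringSite hN k))]) (by simp)
      simp only [List.map_append, List.map_replicate, List.prod_append, List.prod_replicate,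
        List.map_cons, List.map_nil, List.prod_singleton] at this
      rw [this]
      simp [δ, h, h', diagWeight])
    (N := N) hcut'
  have hδ : segment (fun k => δ (ringSite hN k)) s N =
      agreeOff (thicken q A ∪ thicken q B) i j := by
    rw [segment_rotate (fun k => by rw [ringSite_add]), segment_ringSite, List.prod_ofFn]
    unfold agreeOff
    split_ifs with h
    · refine Finset.prod_eq_one fun k _ => ?_
      by_cases hk : k ∈ thicken q A ∪ thicken q B
      · exact if_pos hk
      · simp only [δ, if_neg hk, h k hk, diagWeight, if_true]
    · push Not at h
      obtain ⟨k, hk, hne⟩ := h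
      refine Finset.prod_eq_zero (Finset.mem_univ k) ?_
      simp only [δ, if_neg hk, diagWeight, if_neg hne]
  rw [htrace w i j hw, hfac, hδ, ← htrace wA _ _ fun k hk _ => hA k hk,
    ← htrace wB _ _ fun k _ hk => hB k hk, mul_assoc]

/-- Product weights on distant regions are uncorrelated in the output. -/
lemma Tensor.IsSimple.sum_mul_dilatedOutput {V : Tensor O P I D} {i₀ : I} {q : ℕ}
    (hV : V.IsSimple i₀ q) (hN : 0 < N) {σ : Matrix (Fin N → I) (Fin N → I) ℂ} (hσ : IsState σ)
    {ξ : ℕ} (hξ : HasCorrelationRange σ ξ) {A B : Finset (Fin N)}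
    (hAB : ∀ a ∈ A, ∀ b ∈ B, ξ + 4 * q < ringDist a b) {w wA wB : Fin N → O × P → O × P → ℂ}
    (hwA : ∀ k ∈ A, w k = wA k) (hwB : ∀ k ∈ B, w k = wB k)
    (hw : ∀ k, k ∉ A → k ∉ B → w k = diagWeight _)
    (hA : ∀ k ∉ A, wA k = diagWeight _) (hB : ∀ k ∉ B, wB k = diagWeight _) :
    ∑ s, ∑ t, (∏ k, w k (s k) (t k)) * V.dilatedOutput N σ s t =
      (∑ s, ∑ t, (∏ k, wA k (s k) (t k)) * V.dilatedOutput N σ s t) *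
        ∑ s, ∑ t, (∏ k, wB k (s k) (t k)) * V.dilatedOutput N σ s t := by
  simp only [Tensor.sum_mul_dilatedOutput]
  have hone : ∑ i, ∑ j, V.heisenberg (fun _ => diagWeight (O × P)) i j * σ i j = 1 := by
    rw [← hσ.2]
    simp [Tensor.heisenberg_diagWeight hV.traceDelta hN, Matrix.trace]
  -- An empty region has no distance constraint, so the ring may be too short for a cut; the claim
  -- then reduces to the output having trace one.
  rcases A.eq_empty_or_nonempty with rfl | hAne
  · have h1 : w = wB := funext fun k => by
      by_cases hk : k ∈ B
      · exact hwB k hk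
      · rw [hw k (by simp) hk, hB k hk]
    have h2 : wA = fun _ => diagWeight _ := funext fun k => hA k (by simp)
    rw [h1, h2, hone, one_mul]
  rcases B.eq_empty_or_nonempty with rfl | hBne
  · have h1 : w = wA := funext fun k => by
      by_cases hk : k ∈ A
      · exact hwA k hk
      · rw [hw k hk (by simp), hA k hk]
    have h2 : wB = fun _ => diagWeight _ := funext fun k => hB k (by simp)
    rw [h1, h2, hone, mul_one]
  have hfar := lt_ringDist_of_mem_thicken hAB
  have hd : Disjoint (thicken q A) (thicken q B) := by
    rw [Finset.disjoint_left]
    intro k h1 h2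
    have := hfar k h1 k h2
    rw [ringDist_self] at this
    omega
  have hqN : 2 * q ≤ N := by
    obtain ⟨a, ha⟩ := hAne
    obtain ⟨b, hb⟩ := hBne
    have h1 := hAB a ha b hb
    have h2 : ringDist a b ≤ N := (min_le_right _ _).trans (Nat.sub_le _ _)
    omega
  obtain ⟨s, hs, hcut⟩ := exists_isCut hN hd hAne hBne
  have hempty : thicken q (∅ : Finset (Fin N)) = ∅ := by simp [thicken]
  -- The same factorization with one region empty, using the cut already found, identifies each
  -- factor as the full Heisenberg observable of its region.
  have hsingle : ∀ (C : Finset (Fin N)) (wC : Fin N → O × P → O × P → ℂ), C ⊆ A ∪ B →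
      (∀ k ∉ C, wC k = diagWeight _) → ∀ i j, V.heisenberg wC i j = agreeOff (thicken q C) i j *
        V.heisenberg wC (extend i₀ (thicken q C) fun k => i k)
          (extend i₀ (thicken q C) fun k => j k) := by
    intro C wC hC hCw i j
    have := hV.heisenberg_eq (A := C) (B := ∅) (wA := wC) (wB := fun _ => diagWeight _) (w := wC) hN
      hqN (by rw [hempty]; exact Finset.disjoint_empty_right _)
      ⟨s, hs, hcut.mono (by simpa using hC)⟩ (fun _ _ => rfl) (fun k hk => by simp at hk)
      (fun k hk _ => hCw k hk) hCw (fun _ _ => rfl) i j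
    rw [this, Tensor.heisenberg_diagWeight hV.traceDelta hN]
    have he : ∀ i : (thicken q (∅ : Finset (Fin N))) → I, extend i₀ (thicken q ∅) i = fun _ => i₀ :=
      fun i => funext fun k => extend_of_notMem _ (by simp [hempty])
    simp only [he, if_true, mul_one, hempty, Finset.union_empty]
  rw [Finset.sum_congr rfl fun i _ => Finset.sum_congr rfl fun j _ => by
      rw [hV.heisenberg_eq hN hqN hd ⟨s, hs, hcut⟩ hwA hwB hw hA hB i j],
    hξ.sum_mul hfar (fun i j => V.heisenberg wA (extend i₀ _ i) (extend i₀ _ j))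
      (fun i j => V.heisenberg wB (extend i₀ _ i) (extend i₀ _ j))]
  congr 1
  · exact Finset.sum_congr rfl fun i _ => Finset.sum_congr rfl fun j _ => by
      rw [hsingle A wA Finset.subset_union_left hA i j]
  · exact Finset.sum_congr rfl fun i _ => Finset.sum_congr rfl fun j _ => by
      rw [hsingle B wB Finset.subset_union_right hB i j]

omit [Fintype P] [Fintype I] [DecidableEq P] [DecidableEq I] [Fintype O] [DecidableEq O] in
lemma regionWeight_restrict {S : Type} [DecidableEq S] {A C : Finset (Fin N)} (h : A ⊆ C)
    (x y : C → S) {k : Fin N} (hk : k ∈ A) :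
    regionWeight C x y k = regionWeight A (Finset.restrict₂ (π := fun _ => S) h x)
      (Finset.restrict₂ (π := fun _ => S) h y) k := by
  ext s t
  rw [regionWeight, regionWeight, dif_pos hk, dif_pos (h hk)]
  rfl

omit [Fintype P] [Fintype I] [DecidableEq P] [DecidableEq I] [Fintype O] [DecidableEq O] in
lemma regionWeight_of_notMem {S : Type} [DecidableEq S] {A : Finset (Fin N)}
    (x y : A → S) {k : Fin N} (hk : k ∉ A) : regionWeight A x y k = diagWeight S := by
  ext s t
  rw [regionWeight, dif_neg hk]

omit [DecidableEq O] [DecidableEq I] in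
-- Tracing out the purification means measuring the identity on it, so channel expectations are
-- dilated expectations of product weights.
lemma Tensor.sum_mul_channel (V : Tensor O P I D) (σ : Matrix (Fin N → I) (Fin N → I) ℂ)
    (w : Fin N → O → O → ℂ) :
    ∑ s, ∑ t, (∏ k, w k (s k) (t k)) * V.channel N σ s t =
      ∑ s : Fin N → O × P, ∑ t : Fin N → O × P,
        (∏ k, w k (s k).1 (t k).1 * diagWeight P (s k).2 (t k).2) * V.dilatedOutput N σ s t := by
  let e := Equiv.arrowProdEquivProdArrow (Fin N) (fun _ => O) (fun _ => P)
  rw [← e.symm.sum_comp]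
  simp only [← e.symm.sum_comp (fun t => _ * V.dilatedOutput N σ _ t), Fintype.sum_prod_type]
  refine Finset.sum_congr rfl fun s _ => ?_
  rw [Finset.sum_comm]
  refine Finset.sum_congr rfl fun t _ => ?_
  simp only [Tensor.channel, Matrix.of_apply, Finset.mul_sum, Finset.prod_mul_distrib]
  refine Finset.sum_congr rfl fun p _ => ?_
  have : ∀ p p' : Fin N → P, ∏ k, diagWeight P (e.symm (s, p) k).2 (e.symm (t, p') k).2 =
      if p = p' then 1 else 0 := fun p p' => prod_diagWeight p p'
  simp only [this]
  simp
  rfl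

/-- Entries of a reduced state are expectations of product weights equal to the identity weight off
the region, which reduces both outputs to the factorization of such expectations. -/
theorem Tensor.IsSimple.spreadsCorrelationsAtMost {V : Tensor O P I D} {i₀ : I} {q : ℕ}
    (hV : V.IsSimple i₀ q) : V.SpreadsCorrelationsAtMost (4 * q) := by
  intro N hN σ hσ ξ hξ
  refine ⟨fun A B hAB x y => ?_, fun A B hAB x y => ?_⟩
  · rw [reducedState_eq_sum, reducedState_eq_sum, reducedState_eq_sum]
    exact hV.sum_mul_dilatedOutput hN hσ hξ hAB
      (fun k hk => regionWeight_restrict _ _ _ hk) (fun k hk => regionWeight_restrict _ _ _ hk)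
      (fun k h1 h2 => regionWeight_of_notMem _ _ (by simp [h1, h2]))
      (fun k hk => regionWeight_of_notMem _ _ hk) (fun k hk => regionWeight_of_notMem _ _ hk)
  · have hdiag : (fun s t : O × P => diagWeight O s.1 t.1 * diagWeight P s.2 t.2) =
        diagWeight (O × P) := by
      ext s t
      simp only [diagWeight, Prod.ext_iff]
      by_cases h1 : s.1 = t.1 <;> by_cases h2 : s.2 = t.2 <;> simp [h1, h2]
    rw [reducedState_eq_sum, reducedState_eq_sum, reducedState_eq_sum, V.sum_mul_channel,
      V.sum_mul_channel, V.sum_mul_channel]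
    refine hV.sum_mul_dilatedOutput hN hσ hξ hAB
      (w := fun k s t => regionWeight _ x y k s.1 t.1 * diagWeight P s.2 t.2)
      (wA := fun k s t => regionWeight A _ _ k s.1 t.1 * diagWeight P s.2 t.2)
      (wB := fun k s t => regionWeight B _ _ k s.1 t.1 * diagWeight P s.2 t.2)
      (fun k hk => ?_) (fun k hk => ?_) (fun k h1 h2 => ?_) (fun k hk => ?_) (fun k hk => ?_)
    · simp only [regionWeight_restrict Finset.subset_union_left x y hk]
    · simp only [regionWeight_restrict Finset.subset_union_right x y hk]
    · rw [← hdiag]; simp only [regionWeight_of_notMem x y (show k ∉ A ∪ B by simp [h1, h2])]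
    · rw [← hdiag]; simp only [regionWeight_of_notMem _ _ hk]
    · rw [← hdiag]; simp only [regionWeight_of_notMem _ _ hk]

end Spread

/-! ### Factorizations of Gram matrices -/

section Gram

variable {n : Type*} [Fintype n] [DecidableEq n]

/-- A positive semidefinite matrix is the Gram matrix of a matrix with a right inverse. -/
lemma exists_factor_of_posSemidef {G : Matrix n n ℂ} (hG : G.PosSemidef) :
    ∃ (r : ℕ) (Y : Matrix (Fin r) n ℂ) (Z : Matrix n (Fin r) ℂ), Yᴴ * Y = G ∧ Y * Z = 1 := by
  have hH := hG.isHermitian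
  let ev := hH.eigenvalues
  let U : Matrix n n ℂ := (hH.eigenvectorUnitary : Matrix n n ℂ)
  have hU : Uᴴ * U = 1 := by
    have := (Matrix.mem_unitaryGroup_iff'.1 hH.eigenvectorUnitary.2)
    exact this
  have hspec : G = U * Matrix.diagonal (fun i => (ev i : ℂ)) * Uᴴ := by
    have := hH.spectral_theorem
    rw [Unitary.conjStarAlgAut_apply] at this
    exact this
  have hev : ∀ i, 0 ≤ ev i := hG.eigenvalues_nonneg
  -- Restricting `√Λ U†` to the nonzero eigenvalues makes it surjective, with right inverse `U
  -- Λ^(-1/2)`.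
  let J := {i // ev i ≠ 0}
  let e : Fin (Fintype.card J) ≃ J := (Fintype.equivFin J).symm
  have hs : ∀ p : J, ((Real.sqrt (ev p) : ℝ) : ℂ) ≠ 0 := fun p =>
    Complex.ofReal_ne_zero.2 (Real.sqrt_ne_zero'.2 (lt_of_le_of_ne (hev p) (Ne.symm p.2)))
  have hss : ∀ i, ((Real.sqrt (ev i) : ℝ) : ℂ) * ((Real.sqrt (ev i) : ℝ) : ℂ) = (ev i : ℂ) := by
    intro i
    rw [← Complex.ofReal_mul, Real.mul_self_sqrt (hev i)]
  refine ⟨Fintype.card J,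
    Matrix.of fun p i => ((Real.sqrt (ev (e p)) : ℝ) : ℂ) * star (U i (e p)),
    Matrix.of fun i p => U i (e p) * (((Real.sqrt (ev (e p)) : ℝ) : ℂ))⁻¹, ?_, ?_⟩
  · ext i j
    rw [hspec, Matrix.mul_apply, Matrix.mul_apply]
    simp only [Matrix.mul_diagonal, Matrix.conjTranspose_apply, Matrix.of_apply]
    rw [e.sum_comp fun p : J => star (((Real.sqrt (ev p) : ℝ) : ℂ) * star (U i p)) *
      (((Real.sqrt (ev p) : ℝ) : ℂ) * star (U j p))]
    rw [← Finset.sum_subset (Finset.subset_univ (Finset.univ.filter fun i => ev i ≠ 0)),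
      Finset.sum_subtype (p := fun i => ev i ≠ 0) _ (by simp)]
    · refine Finset.sum_congr rfl fun p _ => ?_
      rw [← hss]
      simp
      ring
    · intro p _ hp
      simp at hp
      simp [hp]
  · ext p p'
    rw [Matrix.mul_apply]
    simp only [Matrix.of_apply]
    have h1 := congrFun (congrFun hU (e p)) (e p')
    rw [Matrix.mul_apply] at h1
    simp only [Matrix.conjTranspose_apply] at h1
    have h2 : ∀ i, ((Real.sqrt (ev (e p)) : ℝ) : ℂ) * star (U i (e p)) *
        (U i (e p') * (((Real.sqrt (ev (e p')) : ℝ) : ℂ))⁻¹) =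
        ((Real.sqrt (ev (e p)) : ℝ) : ℂ) * (((Real.sqrt (ev (e p')) : ℝ) : ℂ))⁻¹ *
          (star (U i (e p)) * U i (e p')) := fun i => by ring
    rw [Finset.sum_congr rfl fun i _ => h2 i, ← Finset.mul_sum, h1]
    by_cases hp : p = p'
    · subst hp
      simp [mul_inv_cancel₀ (hs (e p))]
    · have : (e p : n) ≠ e p' := fun h => hp (e.injective (Subtype.ext h))
      simp [hp, this]

lemma card_le_of_conjTranspose_mul_self {m n : Type*} [Fintype m] [Fintype n] [DecidableEq n]
    {A : Matrix m n ℂ} (h : Aᴴ * A = 1) : Fintype.card n ≤ Fintype.card m := by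
  have h1 : (Aᴴ * A).rank = Fintype.card n := by rw [h, Matrix.rank_one]
  rw [← h1]
  exact (Matrix.rank_mul_le_right _ _).trans (Matrix.rank_le_card_height _)

end Gram

/-! ### Traces of products as sums over closed paths -/

section Path

variable {ι : Type*} [Fintype ι] [DecidableEq ι]

lemma prod_ofFn_apply (n : ℕ) (M : Fin (n + 1) → Matrix ι ι ℂ) (a b : ι) :
    (List.ofFn M).prod a b = ∑ α : Fin (n + 1) → ι, (if α 0 = a then 1 else 0) *
      ((∏ k : Fin n, M k.castSucc (α k.castSucc) (α k.succ)) *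
        M (Fin.last n) (α (Fin.last n)) b) := by
  induction n generalizing a with
  | zero =>
    rw [← (Equiv.funUnique (Fin 1) ι).symm.sum_comp]
    simp
  | succ n ih =>
    rw [List.ofFn_succ, List.prod_cons, Matrix.mul_apply, ← (Fin.consEquiv fun _ => ι).sum_comp,
      Fintype.sum_prod_type]
    simp only [Fin.consEquiv_apply, Fin.cons_zero, Fin.prod_univ_succ, Fin.castSucc_zero,
      ite_mul, one_mul, zero_mul]
    symm
    rw [Finset.sum_eq_single a (fun x _ hx => by simp [hx]) (by simp)]
    symm
    simp only [if_true, ih, Finset.mul_sum]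
    rw [Finset.sum_comm]
    refine Finset.sum_congr rfl fun α _ => ?_
    rw [Finset.sum_eq_single (α 0) (fun x _ hx => by rw [if_neg (Ne.symm hx)]; simp) (by simp)]
    simp [← Fin.succ_last, mul_assoc]

/-- The trace of a product of matrices is a sum over closed paths. -/
lemma trace_prod_ofFn {n : ℕ} (hn : 1 ≤ n) (M : Fin n → Matrix ι ι ℂ) :
    (List.ofFn M).prod.trace = ∑ α : Fin n → ι, ∏ k, M k (α k) (α (finRotate n k)) := by
  obtain ⟨n, rfl⟩ := Nat.exists_eq_add_of_le' hn
  unfold Matrix.trace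
  simp only [Matrix.diag_apply, prod_ofFn_apply]
  rw [Finset.sum_comm]
  refine Finset.sum_congr rfl fun α _ => ?_
  rw [Finset.sum_eq_single (α 0) (fun x _ hx => by simp [hx.symm]) (by simp), if_pos rfl, one_mul,
    Fin.prod_univ_castSucc, finRotate_last]
  congr 1
  refine Finset.prod_congr rfl fun k _ => ?_
  simp

omit [Fintype ι] [DecidableEq ι] in
lemma prod_ofFn_mul {R : Type*} [Monoid R] (m : ℕ) (A B : Fin (m + 1) → R) :
    (List.ofFn fun k => A k * B k).prod =
      A 0 * (List.ofFn fun k : Fin m => B k.castSucc * A k.succ).prod * B (Fin.last m) := by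
  induction m with
  | zero => simp
  | succ m ih =>
    rw [List.ofFn_succ, List.prod_cons, ih (fun k => A k.succ) (fun k => B k.succ), List.ofFn_succ,
      List.prod_cons]
    simp [mul_assoc]

/-- A closed alternating product only depends on the products across the bonds `B k * A k'`. -/
lemma trace_prod_ofFn_mul_congr {n : ℕ} (hn : 1 ≤ n) {A B A' B' : Fin n → Matrix ι ι ℂ}
    (h : ∀ k k', B k * A k' = B' k * A' k') :
    (List.ofFn fun k => A k * B k).prod.trace = (List.ofFn fun k => A' k * B' k).prod.trace := by
  obtain ⟨n, rfl⟩ := Nat.exists_eq_add_of_le' hn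
  rw [prod_ofFn_mul, prod_ofFn_mul, Matrix.trace_mul_comm, Matrix.trace_mul_comm _ (B' _),
    ← mul_assoc, ← mul_assoc, h]
  simp only [h]

end Path

/-! ### Alternating matrix product operators -/

section Alternating

open scoped Kronecker

variable {S I : Type} {D : ℕ}

/-- The configurations of `2 * n` sites are those of `n` pairs of sites. -/
def pairEquiv (X : Type) (n : ℕ) : (Fin n → X × X) ≃ (Fin (2 * n) → X) where
  toFun w m := if m.1 % 2 = 0 then (w ⟨m.1 / 2, by omega⟩).1 else (w ⟨m.1 / 2, by omega⟩).2
  invFun s k := (s (leftSite k), s (rightSite k))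
  left_inv w := by
    ext k
    · simp [leftSite]
    · have h1 : (2 * k.1 + 1) % 2 = 1 := by omega
      have h2 : (2 * k.1 + 1) / 2 = k.1 := by omega
      simp [rightSite, h1, h2]
  right_inv s := by
    ext m
    by_cases h : m.1 % 2 = 0
    · simp only [h, if_true, leftSite]
      congr 1; ext; simp only; omega
    · simp only [h, if_false, rightSite]
      congr 1; ext; simp only; omega

/-- The matrix product operator on `2 * n` sites with the tensor `A` on the even and `B` on the odd
sites. -/
def alternating (A B : S → I → Matrix (Fin D) (Fin D) ℂ) (n : ℕ) :
    Matrix (Fin (2 * n) → S) (Fin (2 * n) → I) ℂ :=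
  Matrix.of fun s i => (List.ofFn fun k : Fin n =>
    A (s (leftSite k)) (i (leftSite k)) * B (s (rightSite k)) (i (rightSite k))).prod.trace

lemma Tensor.mpo_eq_alternating {O P : Type} (V : Tensor O P I D) (n : ℕ) :
    V.mpo (2 * n) = alternating V.merged V.merged n := by
  ext s i
  simp only [Tensor.mpo, alternating, Matrix.of_apply]
  rw [List.ofFn_mul', List.prod_flatten, List.map_ofFn]
  congr 3
  ext1 k
  simp [leftSite, rightSite, Tensor.merged]

lemma transfer_mul [Fintype S] [DecidableEq S] (A B A' B' : S → I → Matrix (Fin D) (Fin D) ℂ)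
    (x y : I × I) :
    transfer (fun (s : S × S) (i : I × I) => A s.1 i.1 * B s.2 i.2)
        (fun (s : S × S) (i : I × I) => A' s.1 i.1 * B' s.2 i.2) (diagWeight (S × S)) x y =
      transfer A A' (diagWeight S) x.1 y.1 * transfer B B' (diagWeight S) x.2 y.2 := by
  rw [transfer_diagWeight, transfer_diagWeight, transfer_diagWeight, Finset.sum_mul_sum,
    Fintype.sum_prod_type]
  refine Finset.sum_congr rfl fun s _ => Finset.sum_congr rfl fun t _ => ?_
  rw [← Matrix.mul_kronecker_mul]
  congr 1
  exact Matrix.map_mul (f := starRingEnd ℂ)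

lemma conjTranspose_alternating_mul [Fintype S] [DecidableEq S]
    (A B A' B' : S → I → Matrix (Fin D) (Fin D) ℂ) (n : ℕ) (i j : Fin (2 * n) → I) :
    ((alternating A B n)ᴴ * alternating A' B' n) j i = (List.ofFn fun k : Fin n =>
      transfer A A' (diagWeight S) (i (leftSite k)) (j (leftSite k)) *
        transfer B B' (diagWeight S) (i (rightSite k)) (j (rightSite k))).prod.trace := by
  have h := sum_prod_mul_trace (N := n)
    (fun _ (s : S × S) (i : I × I) => A s.1 i.1 * B s.2 i.2)
    (fun _ (s : S × S) (i : I × I) => A' s.1 i.1 * B' s.2 i.2)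
    (fun _ => diagWeight (S × S)) ((pairEquiv I n).symm i) ((pairEquiv I n).symm j)
  simp only [transfer_mul] at h
  refine Eq.trans ?_ h
  rw [sum_diagWeight, Matrix.mul_apply, ← (pairEquiv S n).symm.sum_comp]
  rfl

/-- The operator that is generated by two neighbouring tensors, including the outer bonds. -/
def pairMatrix (A B : S → I → Matrix (Fin D) (Fin D) ℂ) :
    Matrix (S × S) ((I × Fin D) × (I × Fin D)) ℂ :=
  Matrix.of fun s x => (A s.1 x.1.1 * B s.2 x.2.1) x.1.2 x.2.2

/-- The same numbers regrouped: matrix multiplication of transfer matrices pairs left bonds against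
right bonds, whereas the Gram matrix pairs bra against ket. -/
lemma transfer_mul_transfer_apply [Fintype S] [DecidableEq S]
    (A B A' B' : S → I → Matrix (Fin D) (Fin D) ℂ) (i j k l : I) (a a' d d' : Fin D) :
    (transfer A A' (diagWeight S) i j * transfer B B' (diagWeight S) k l) (a, a') (d, d') =
      ((pairMatrix A B)ᴴ * pairMatrix A' B') ((j, a), (l, d)) ((i, a'), (k, d')) := by
  rw [transfer_diagWeight, transfer_diagWeight, Finset.sum_mul_sum, Matrix.mul_apply,
    Fintype.sum_prod_type, Matrix.sum_apply]
  refine Finset.sum_congr rfl fun s _ => ?_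
  rw [Matrix.sum_apply]
  refine Finset.sum_congr rfl fun t _ => ?_
  rw [← Matrix.mul_kronecker_mul, Matrix.kroneckerMap_apply]
  simp only [pairMatrix, Matrix.conjTranspose_apply, Matrix.of_apply]
  congr 1
  have : ((A s j).map star * (B t l).map star) = (A s j * B t l).map star :=
    (Matrix.map_mul (f := starRingEnd ℂ)).symm
  rw [this, Matrix.map_apply]

/-- The tensor with its left bond and physical input transformed by `Q`. -/
def mulLeftLeg [Fintype I] (A : S → I → Matrix (Fin D) (Fin D) ℂ)
    (Q : Matrix (I × Fin D) (I × Fin D) ℂ) : S → I → Matrix (Fin D) (Fin D) ℂ :=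
  fun s i => Matrix.of fun α β => ∑ x : I × Fin D, A s x.1 x.2 β * Q x (i, α)

/-- The tensor with its right bond and physical input transformed by `Q`. -/
def mulRightLeg [Fintype I] (A : S → I → Matrix (Fin D) (Fin D) ℂ)
    (Q : Matrix (I × Fin D) (I × Fin D) ℂ) : S → I → Matrix (Fin D) (Fin D) ℂ :=
  fun s i => Matrix.of fun α β => ∑ x : I × Fin D, A s x.1 α x.2 * Q x (i, β)

variable [Fintype I]

lemma mulLeftLeg_one [DecidableEq I] (A : S → I → Matrix (Fin D) (Fin D) ℂ) :
    mulLeftLeg A 1 = A := by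
  funext s i
  ext α β
  simp [mulLeftLeg, Matrix.one_apply]

lemma mulRightLeg_one [DecidableEq I] (A : S → I → Matrix (Fin D) (Fin D) ℂ) :
    mulRightLeg A 1 = A := by
  funext s i
  ext α β
  simp [mulRightLeg, Matrix.one_apply]

lemma pairMatrix_mulLeg (A B : S → I → Matrix (Fin D) (Fin D) ℂ)
    (Q Q' : Matrix (I × Fin D) (I × Fin D) ℂ) :
    pairMatrix (mulLeftLeg A Q) (mulRightLeg B Q') = pairMatrix A B * (Q ⊗ₖ Q') := by
  ext s x
  simp only [pairMatrix, mulLeftLeg, mulRightLeg, Matrix.of_apply, Matrix.mul_apply,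
    Matrix.kroneckerMap_apply, Finset.sum_mul_sum]
  rw [Finset.sum_comm]
  refine Eq.trans ?_ (Fintype.sum_prod_type _).symm
  refine Finset.sum_congr rfl fun y _ => ?_
  rw [Finset.sum_comm]
  refine Finset.sum_congr rfl fun z _ => ?_
  rw [Finset.sum_mul]
  exact Finset.sum_congr rfl fun c _ => by ring

end Alternating

/-! ### Brick-wall circuits from factorizations -/

section Brickwall

open scoped Kronecker

variable {S I : Type} {D l r : ℕ}

/-- The lower gate. -/
def lowerGate (Y : Matrix (Fin l) (I × Fin D) ℂ) (Y' : Matrix (Fin r) (I × Fin D) ℂ) :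
    Matrix (Fin l × Fin r) (I × I) ℂ :=
  Matrix.of fun w i => ∑ β, Y w.1 (i.1, β) * Y' w.2 (i.2, β)

/-- The upper gate. -/
def upperGate [Fintype I] (A : S → I → Matrix (Fin D) (Fin D) ℂ) (Z : Matrix (I × Fin D) (Fin l) ℂ)
    (Z' : Matrix (I × Fin D) (Fin r) ℂ) : Matrix (S × S) (Fin r × Fin l) ℂ :=
  pairMatrix A A * (Z' ⊗ₖ Z)

/-- `u` contracts the bond inside a pair and `v` the bond between pairs. Contracting the wires
leaves `Z * Y` on the right leg of each even tensor and `Z' * Y'` on the left leg of each odd one.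
-/
lemma brickwall_eq_alternating [Fintype I] (A : S → I → Matrix (Fin D) (Fin D) ℂ)
    (Y : Matrix (Fin l) (I × Fin D) ℂ) (Z : Matrix (I × Fin D) (Fin l) ℂ)
    (Y' : Matrix (Fin r) (I × Fin D) ℂ) (Z' : Matrix (I × Fin D) (Fin r) ℂ) {n : ℕ} (hn : 1 ≤ n) :
    brickwall (lowerGate Y Y') (upperGate A Z Z') n =
      alternating (mulRightLeg A (Z * Y)) (mulLeftLeg A (Z' * Y')) n := by
  ext s i
  let X : S → Fin D → Fin l → ℂ := fun t α a => ∑ x : I × Fin D, A t x.1 α x.2 * Z x a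
  let X' : S → Fin D → Fin r → ℂ := fun t β b => ∑ x : I × Fin D, A t x.1 x.2 β * Z' x b
  have hv : ∀ t t' b a, upperGate A Z Z' (t, t') (b, a) = ∑ β, X' t β b * X t' β a := by
    intro t t' b a
    simp only [upperGate, pairMatrix, Matrix.mul_apply, Matrix.of_apply, Matrix.kroneckerMap_apply,
      X, X', Finset.sum_mul_sum]
    symm
    rw [Finset.sum_comm]
    refine Eq.trans ?_ (Fintype.sum_prod_type _).symm
    refine Finset.sum_congr rfl fun y _ => ?_
    rw [Finset.sum_comm]
    refine Finset.sum_congr rfl fun z _ => ?_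
    rw [Finset.sum_mul]
    exact Finset.sum_congr rfl fun c _ => by ring
  have hR : ∀ t i α β, mulRightLeg A (Z * Y) t i α β = ∑ a, X t α a * Y a (i, β) := by
    intro t i α β
    simp only [mulRightLeg, Matrix.of_apply, Matrix.mul_apply, X, Finset.mul_sum, Finset.sum_mul]
    rw [Finset.sum_comm]
    simp only [mul_assoc]
  have hL : ∀ t i α β, mulLeftLeg A (Z' * Y') t i α β = ∑ b, X' t β b * Y' b (i, α) := by
    intro t i α β
    simp only [mulLeftLeg, Matrix.of_apply, Matrix.mul_apply, X', Finset.mul_sum, Finset.sum_mul]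
    rw [Finset.sum_comm]
    simp only [mul_assoc]
  have hpair : ∀ t t' i i' α α',
      (mulRightLeg A (Z * Y) t i * mulLeftLeg A (Z' * Y') t' i') α α' =
        ∑ w : Fin l × Fin r, X t α w.1 * lowerGate Y Y' w (i, i') * X' t' α' w.2 := by
    intro t t' i i' α α'
    simp only [Matrix.mul_apply, hR, hL, Finset.sum_mul_sum, lowerGate, Matrix.of_apply,
      Fintype.sum_prod_type]
    simp only [Finset.mul_sum, Finset.sum_mul]
    rw [Finset.sum_comm]
    refine Finset.sum_congr rfl fun a _ => ?_
    rw [Finset.sum_comm]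
    exact Finset.sum_congr rfl fun b _ => Finset.sum_congr rfl fun β _ => by ring
  simp only [alternating, Matrix.of_apply]
  rw [trace_prod_ofFn hn]
  simp only [hpair, brickwall, upperLayer, lowerLayer, Matrix.mul_apply, Matrix.of_apply, hv]
  have hexp : ∀ α : Fin n → Fin D,
      (∏ k, ∑ w : Fin l × Fin r, X (s (leftSite k)) (α k) w.1 *
        lowerGate Y Y' w (i (leftSite k), i (rightSite k)) *
        X' (s (rightSite k)) (α (finRotate n k)) w.2) =
      ∑ w : Fin n → Fin l × Fin r, (∏ k, (X' (s (rightSite k)) (α (finRotate n k)) (w k).2 *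
        X (s (leftSite (finRotate n k))) (α (finRotate n k)) (w (finRotate n k)).1)) *
        ∏ k, lowerGate Y Y' (w k) (i (leftSite k), i (rightSite k)) := by
    intro α
    rw [Fintype.prod_sum]
    refine Finset.sum_congr rfl fun w _ => ?_
    rw [Finset.prod_mul_distrib, Finset.prod_mul_distrib, Finset.prod_mul_distrib,
      Equiv.prod_comp (finRotate n) fun k => X (s (leftSite k)) (α k) (w k).1]
    ring
  simp only [hexp]
  rw [Finset.sum_comm]
  refine Finset.sum_congr rfl fun w _ => ?_
  rw [← Finset.sum_mul, Fintype.prod_sum]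
  congr 1
  -- The bond summed inside the `k`-th gate `v` is the left bond of pair `k + 1`.
  rw [← ((finRotate n).symm.arrowCongr (Equiv.refl (Fin D))).sum_comp]
  refine Finset.sum_congr rfl fun α _ => Finset.prod_congr rfl fun k _ => ?_
  simp

/-- If the transfer matrices of a tensor factorize across a bond into positive parts, then the tensor
generates a brick-wall circuit of isometries. -/
theorem exists_brickwall [Fintype S] [DecidableEq S] [Fintype I] [DecidableEq I]
    (A : S → I → Matrix (Fin D) (Fin D) ℂ) {G G' : Matrix (I × Fin D) (I × Fin D) ℂ}
    (hG : G.PosSemidef) (hG' : G'.PosSemidef)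
    (hfac : (pairMatrix A A)ᴴ * pairMatrix A A = G' ⊗ₖ G)
    (hone : ∀ i j k l, ∑ β, ∑ β', G (i, β) (j, β') * G' (k, β) (l, β') =
      diagWeight I i j * diagWeight I k l)
    (hiso : ∀ n, 1 ≤ n → (alternating A A n)ᴴ * alternating A A n = 1) :
    ∃ (l r : ℕ) (u : Matrix (Fin l × Fin r) (I × I) ℂ) (v : Matrix (S × S) (Fin r × Fin l) ℂ),
      uᴴ * u = 1 ∧ vᴴ * v = 1 ∧ ∀ n, 1 ≤ n → alternating A A n = brickwall u v n := by
  obtain ⟨l, Y, Z, hY, hYZ⟩ := exists_factor_of_posSemidef hG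
  obtain ⟨r, Y', Z', hY', hYZ'⟩ := exists_factor_of_posSemidef hG'
  have hZGZ : Zᴴ * G * Z = 1 := by
    rw [← hY, ← Matrix.mul_assoc, Matrix.mul_assoc, hYZ, Matrix.mul_one, ← Matrix.conjTranspose_mul, hYZ,
      Matrix.conjTranspose_one]
  have hZGZ' : Z'ᴴ * G' * Z' = 1 := by
    rw [← hY', ← Matrix.mul_assoc, Matrix.mul_assoc, hYZ', Matrix.mul_one, ← Matrix.conjTranspose_mul, hYZ',
      Matrix.conjTranspose_one]
  refine ⟨l, r, lowerGate Y Y', upperGate A Z Z', ?_, ?_, fun n hn => ?_⟩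
  · ext ⟨i, k⟩ ⟨j, m⟩
    have h := hone i j k m
    rw [← hY, ← hY'] at h
    rw [show (1 : Matrix (I × I) (I × I) ℂ) (i, k) (j, m) =
      diagWeight I i j * diagWeight I k m by
        simp only [Matrix.one_apply, diagWeight, Prod.mk.injEq]
        by_cases h1 : i = j <;> by_cases h2 : k = m <;> simp [h1, h2], ← h]
    simp only [Matrix.mul_apply, Matrix.conjTranspose_apply, lowerGate, Matrix.of_apply, star_sum,
      Finset.sum_mul_sum, Fintype.sum_prod_type, star_mul']
    symm
    calc _ = ∑ a, ∑ b, ∑ β, ∑ β', star (Y a (i, β)) * Y a (j, β') *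
          (star (Y' b (k, β)) * Y' b (m, β')) := by
            rw [Finset.sum_congr rfl fun β _ => Finset.sum_comm, Finset.sum_comm]
            refine Finset.sum_congr rfl fun a _ => ?_
            rw [Finset.sum_congr rfl fun β _ => Finset.sum_comm, Finset.sum_comm]
      _ = _ := by
            refine Finset.sum_congr rfl fun a _ => Finset.sum_congr rfl fun b _ =>
              Finset.sum_congr rfl fun β _ => Finset.sum_congr rfl fun β' _ => by ring
  · rw [upperGate, Matrix.conjTranspose_mul, Matrix.mul_assoc, ← Matrix.mul_assoc _ (pairMatrix A A), hfac,
      Matrix.conjTranspose_kronecker, ← Matrix.mul_kronecker_mul, ← Matrix.mul_kronecker_mul,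
      ← Matrix.mul_assoc, ← Matrix.mul_assoc, hZGZ, hZGZ', Matrix.one_kronecker_one]
  · rw [brickwall_eq_alternating A Y Z Y' Z' hn]
    set Q := Z * Y
    set Q' := Z' * Y'
    have hGQ : G * Q = G := by
      rw [← hY, Matrix.mul_assoc, ← Matrix.mul_assoc Y, hYZ, Matrix.one_mul]
    have hGQ' : G' * Q' = G' := by
      rw [← hY', Matrix.mul_assoc, ← Matrix.mul_assoc Y', hYZ', Matrix.one_mul]
    have hQG : Qᴴ * G = G := by
      have := congrArg Matrix.conjTranspose hGQ
      rwa [Matrix.conjTranspose_mul, hG.isHermitian.eq] at this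
    have hQG' : Q'ᴴ * G' = G' := by
      have := congrArg Matrix.conjTranspose hGQ'
      rwa [Matrix.conjTranspose_mul, hG'.isHermitian.eq] at this
    -- Across each odd-even bond the overlap involves only the Gram matrix `G' ⊗ G`, which absorbs
    -- these leg transformations. All such overlaps therefore equal that of the original operator
    -- with itself.
    have hoverlap : ∀ Q₁ Q₁' Q₂ Q₂' : Matrix (I × Fin D) (I × Fin D) ℂ, Q₁ᴴ * G = G →
        Q₁'ᴴ * G' = G' → G * Q₂ = G → G' * Q₂' = G' →
        (alternating (mulRightLeg A Q₁) (mulLeftLeg A Q₁') n)ᴴ *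
          alternating (mulRightLeg A Q₂) (mulLeftLeg A Q₂') n = 1 := by
      intro Q₁ Q₁' Q₂ Q₂' h1 h1' h2 h2'
      rw [← hiso n hn]
      ext j i
      rw [conjTranspose_alternating_mul, conjTranspose_alternating_mul]
      refine trace_prod_ofFn_mul_congr hn fun k k' => ?_
      ext ⟨a, a'⟩ ⟨d, d'⟩
      rw [transfer_mul_transfer_apply, transfer_mul_transfer_apply, pairMatrix_mulLeg,
        pairMatrix_mulLeg, Matrix.conjTranspose_mul, Matrix.mul_assoc, ← Matrix.mul_assoc _ (pairMatrix A A), hfac,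
        Matrix.conjTranspose_kronecker, ← Matrix.mul_kronecker_mul, ← Matrix.mul_kronecker_mul,
        h2, h2', h1, h1']
    have hAA : alternating A A n = alternating (mulRightLeg A 1) (mulLeftLeg A 1) n := by
      rw [mulRightLeg_one, mulLeftLeg_one]
    -- For the difference `X` of the two operators, `X† X = 1 - 1 - 1 + 1 = 0`.
    rw [hAA, ← sub_eq_zero, ← Matrix.conjTranspose_mul_self_eq_zero, Matrix.conjTranspose_sub,
      Matrix.sub_mul, Matrix.mul_sub, Matrix.mul_sub, hoverlap 1 1 1 1 (by simp) (by simp) (by simp) (by simp),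
      hoverlap 1 1 Q Q' (by simp) (by simp) hGQ hGQ', hoverlap Q Q' 1 1 hQG hQG' (by simp) (by simp),
      hoverlap Q Q' Q Q' hQG hQG' hGQ hGQ']
    simp

end Brickwall

/-! ### Simple tensors generate brick-wall circuits -/

section Simple

open scoped Kronecker

/-- The maximally entangled vector on two copies of the bond space. -/
def bondPairing (D : ℕ) : Fin D × Fin D → ℂ := fun x => if x.1 = x.2 then 1 else 0

lemma bondPairing_dotProduct {D : ℕ} (x : Fin D × Fin D → ℂ) :
    bondPairing D ⬝ᵥ x = ∑ γ, x (γ, γ) := by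
  simp [bondPairing, dotProduct, Fintype.sum_prod_type]

lemma dotProduct_bondPairing {D : ℕ} (x : Fin D × Fin D → ℂ) :
    x ⬝ᵥ bondPairing D = ∑ γ, x (γ, γ) := by
  rw [dotProduct_comm, bondPairing_dotProduct]

lemma diagWeight_comm {X : Type} [DecidableEq X] (x y : X) : diagWeight X x y = diagWeight X y x := by
  simp [diagWeight, eq_comm]

lemma kronecker_star_mul {D : ℕ} (X Y X' Y' : Matrix (Fin D) (Fin D) ℂ) :
    (X.map star ⊗ₖ Y) * (X'.map star ⊗ₖ Y') = (X * X').map star ⊗ₖ (Y * Y') := by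
  rw [← Matrix.mul_kronecker_mul]
  congr 1
  exact (Matrix.map_mul (f := starRingEnd ℂ)).symm

variable {O P I : Type} {D : ℕ} [Fintype O] [Fintype P] [DecidableEq O] [DecidableEq P]

lemma Tensor.normTransfer_eq (V : Tensor O P I D) (x : I × I) :
    V.normTransfer x = ∑ s, (V.merged s x.2).map star ⊗ₖ V.merged s x.1 :=
  transfer_diagWeight _ _ _ _

/-- This number is the squared Hilbert-Schmidt norm of the vacuum tensor, so it can vanish only if
the vacuum transfer matrix does. It serves as a nonzero normalization. -/
lemma Tensor.exists_sum_normTransfer_eq (V : Tensor O P I D) (i₀ : I) :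
    ∃ c : ℝ, 0 ≤ c ∧ bondPairing D ⬝ᵥ (V.normTransfer (i₀, i₀) *ᵥ bondPairing D) = (c : ℂ) ∧
      (c = 0 → V.normTransfer (i₀, i₀) = 0) := by
  refine ⟨∑ s, ∑ γ, ∑ γ', Complex.normSq (V.merged s i₀ γ γ'), ?_, ?_, fun h => ?_⟩
  · exact Finset.sum_nonneg fun s _ => Finset.sum_nonneg fun _ _ => Finset.sum_nonneg fun _ _ =>
      Complex.normSq_nonneg _
  · rw [bondPairing_dotProduct, V.normTransfer_eq]
    have : ∀ γ, ((∑ s, (V.merged s i₀).map star ⊗ₖ V.merged s i₀) *ᵥ bondPairing D) (γ, γ) =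
        ∑ s, ∑ γ', ((Complex.normSq (V.merged s i₀ γ γ') : ℝ) : ℂ) := by
      intro γ
      rw [Matrix.mulVec, dotProduct_bondPairing, Finset.sum_comm]
      refine Finset.sum_congr rfl fun γ' _ => ?_
      rw [Matrix.sum_apply]
      refine Finset.sum_congr rfl fun s _ => ?_
      simp [Matrix.kroneckerMap_apply, Complex.normSq_eq_conj_mul_self]
    simp only [this]
    rw [Finset.sum_comm]
    push_cast
    rfl
  · rw [V.normTransfer_eq]
    refine Finset.sum_eq_zero fun s _ => ?_
    have h0 : V.merged s i₀ = 0 := by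
      ext γ γ'
      have hn : ∀ x : ℂ, 0 ≤ Complex.normSq x := Complex.normSq_nonneg
      have h1 := (Finset.sum_eq_zero_iff_of_nonneg fun s _ => Finset.sum_nonneg fun _ _ =>
        Finset.sum_nonneg fun _ _ => hn _).1 h s (Finset.mem_univ s)
      have h2 := (Finset.sum_eq_zero_iff_of_nonneg fun _ _ =>
        Finset.sum_nonneg fun _ _ => hn _).1 h1 γ (Finset.mem_univ γ)
      have h3 := (Finset.sum_eq_zero_iff_of_nonneg fun _ _ => hn _).1 h2 γ' (Finset.mem_univ γ')
      exact Complex.normSq_eq_zero.1 h3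
    rw [h0, Matrix.kronecker_zero]

/-- The transfer matrices, closed on the right by the vacuum, as a Gram matrix. -/
lemma Tensor.posSemidef_right (V : Tensor O P I D) [Fintype I] (i₀ : I) :
    (Matrix.of fun x y : I × Fin D => ((V.normTransfer (y.1, x.1) * V.normTransfer (i₀, i₀)) *ᵥ
      bondPairing D) (x.2, y.2)).PosSemidef := by
  let B : Matrix (((O × P) × (O × P)) × Fin D) (I × Fin D) ℂ :=
    Matrix.of fun s x => (V.merged s.1.1 x.1 * V.merged s.1.2 i₀) x.2 s.2
  have hB : ∀ x y, (Bᴴ * B) x y = ∑ s, ∑ t, ∑ γ, star (B ((s, t), γ) x) * B ((s, t), γ) y := by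
    intro x y
    rw [Matrix.mul_apply, Fintype.sum_prod_type, Fintype.sum_prod_type]
    rfl
  convert Matrix.posSemidef_conjTranspose_mul_self B using 1
  ext x y
  rw [Matrix.of_apply, Matrix.mulVec, dotProduct_bondPairing, V.normTransfer_eq, V.normTransfer_eq,
    Finset.sum_mul_sum, hB]
  simp only [kronecker_star_mul, Matrix.sum_apply]
  rw [Finset.sum_comm]
  refine Finset.sum_congr rfl fun s _ => ?_
  rw [Finset.sum_comm]
  rfl

/-- The transfer matrices, closed on the left by the vacuum, as a Gram matrix. -/
lemma Tensor.posSemidef_left (V : Tensor O P I D) [Fintype I] (i₀ : I) :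
    (Matrix.of fun x y : I × Fin D => (bondPairing D ᵥ* (V.normTransfer (i₀, i₀) *
      V.normTransfer (y.1, x.1))) (x.2, y.2)).PosSemidef := by
  let B : Matrix (((O × P) × (O × P)) × Fin D) (I × Fin D) ℂ :=
    Matrix.of fun s x => (V.merged s.1.1 i₀ * V.merged s.1.2 x.1) s.2 x.2
  have hB : ∀ x y, (Bᴴ * B) x y = ∑ s, ∑ t, ∑ γ, star (B ((s, t), γ) x) * B ((s, t), γ) y := by
    intro x y
    rw [Matrix.mul_apply, Fintype.sum_prod_type, Fintype.sum_prod_type]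
    rfl
  convert Matrix.posSemidef_conjTranspose_mul_self B using 1
  ext x y
  rw [Matrix.of_apply, Matrix.vecMul, bondPairing_dotProduct, V.normTransfer_eq, V.normTransfer_eq,
    Finset.sum_mul_sum, hB]
  simp only [kronecker_star_mul, Matrix.sum_apply]
  rw [Finset.sum_comm]
  refine Finset.sum_congr rfl fun s _ => ?_
  rw [Finset.sum_comm]
  rfl

/-- The rank-one `E` between two letters separates left from right. Cutting it with the maximally
entangled vector, instead of an arbitrary rank-one splitting, makes both halves Gram matrices. -/
theorem Tensor.IsSimple.exists_brickwall [Fintype I] [DecidableEq I] {V : Tensor O P I D} {i₀ : I}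
    (hV : V.IsSimple i₀ 1) :
    ∃ (l r : ℕ) (u : Matrix (Fin l × Fin r) (I × I) ℂ)
      (v : Matrix ((O × P) × (O × P)) (Fin r × Fin l) ℂ),
      uᴴ * u = 1 ∧ vᴴ * v = 1 ∧ ∀ n, 1 ≤ n → V.mpo (2 * n) = brickwall u v n := by
  set E := V.normTransfer (i₀, i₀) with hE
  have hEE : E * E = E := by have := hV.absorbs.idem; rwa [pow_one] at this
  have htr : E.trace = 1 := by simpa using hV.traceDelta.trace_pow i₀ 0
  have hins : ∀ x y, V.normTransfer x * V.normTransfer y =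
      V.normTransfer x * E * V.normTransfer y := by
    intro x y
    have := hV.absorbs.insert [V.normTransfer x] [V.normTransfer y] (by simp) (by simp) (by simp)
      (by simp)
    simpa using this
  obtain ⟨c, hc0, hc, hcz⟩ := V.exists_sum_normTransfer_eq i₀
  have hcne : (c : ℂ) ≠ 0 := by
    intro h
    have := hcz (by exact_mod_cast h)
    rw [← hE] at this
    rw [this] at htr
    simp at htr
  have hEJ : (E * Matrix.vecMulVec (bondPairing D) (bondPairing D)).trace = c := by
    rw [Matrix.mul_vecMulVec, Matrix.trace_vecMulVec, dotProduct_comm, hc]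
  -- Hence `E = c⁻¹ E |Ω⟩⟨Ω| E`, with `Ω` the bond pairing; the factor `c⁻¹` is put into `G`.
  have hEJE : E * Matrix.vecMulVec (bondPairing D) (bondPairing D) * E = (c : ℂ) • E := by
    rw [mul_mul_eq_trace_smul hEE htr, hEJ]
  let G : Matrix (I × Fin D) (I × Fin D) ℂ := (c : ℂ)⁻¹ • Matrix.of fun x y =>
    (bondPairing D ᵥ* (E * V.normTransfer (y.1, x.1))) (x.2, y.2)
  let G' : Matrix (I × Fin D) (I × Fin D) ℂ := Matrix.of fun x y =>
    ((V.normTransfer (y.1, x.1) * E) *ᵥ bondPairing D) (x.2, y.2)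
  have hG : G.PosSemidef := by
    refine (V.posSemidef_left i₀).smul ?_
    rw [← Complex.ofReal_inv]
    exact Complex.zero_le_real.2 (inv_nonneg.2 hc0)
  simp only [V.mpo_eq_alternating]
  refine MPI.exists_brickwall V.merged hG (V.posSemidef_right i₀) ?_ ?_ ?_
  · ext ⟨⟨j, a⟩, ⟨l, d⟩⟩ ⟨⟨i, a'⟩, ⟨k, d'⟩⟩
    rw [← transfer_mul_transfer_apply]
    change (V.normTransfer (i, j) * V.normTransfer (k, l)) (a, a') (d, d') =
      ((V.normTransfer (i, j) * E) *ᵥ bondPairing D) (a, a') *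
        ((c : ℂ)⁻¹ * (bondPairing D ᵥ* (E * V.normTransfer (k, l))) (d, d'))
    have h1 : Matrix.vecMulVec ((V.normTransfer (i, j) * E) *ᵥ bondPairing D)
        (bondPairing D ᵥ* (E * V.normTransfer (k, l))) =
        (c : ℂ) • (V.normTransfer (i, j) * E * V.normTransfer (k, l)) := by
      rw [← Matrix.mul_vecMulVec, ← Matrix.vecMulVec_mul, mul_assoc _ E, ← mul_assoc _ E (V.normTransfer _),
        ← mul_assoc E, ← mul_assoc E, hEJE]
      simp [mul_assoc]
    have h2 := congrFun (congrFun h1 (a, a')) (d, d')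
    rw [Matrix.vecMulVec_apply, Matrix.smul_apply, smul_eq_mul] at h2
    rw [hins, mul_left_comm, h2, ← mul_assoc, inv_mul_cancel₀ hcne, one_mul]
  · intro i j k l
    change ∑ β, ∑ β', ((c : ℂ)⁻¹ * (bondPairing D ᵥ* (E * V.normTransfer (j, i))) (β, β')) *
      ((V.normTransfer (l, k) * E) *ᵥ bondPairing D) (β, β') = _
    have h1 : (E * V.normTransfer (j, i) * V.normTransfer (l, k)).trace =
        diagWeight I i j * diagWeight I k l := by
      have := hV.traceDelta [(i₀, i₀), (j, i), (l, k)] (by simp)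
      simp only [List.map_cons, List.map_nil, List.prod_cons, List.prod_nil, mul_one,
        ← mul_assoc] at this
      rw [hE, this, diagWeight_comm i, diagWeight_comm k]
      simp [diagWeight]
    have h2 : (bondPairing D ᵥ* (E * V.normTransfer (j, i))) ⬝ᵥ
        ((V.normTransfer (l, k) * E) *ᵥ bondPairing D) = c * (diagWeight I i j * diagWeight I k l) := by
      rw [← Matrix.dotProduct_mulVec, Matrix.mulVec_mulVec, ← mul_assoc,
        mul_assoc E, mul_mul_eq_trace_smul hEE htr, Matrix.smul_mulVec, dotProduct_smul, hc,
        ← mul_assoc E, h1, smul_eq_mul, mul_comm]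
    rw [← Fintype.sum_prod_type' fun β β' => (c : ℂ)⁻¹ * (bondPairing D ᵥ* (E *
      V.normTransfer (j, i))) (β, β') * ((V.normTransfer (l, k) * E) *ᵥ bondPairing D) (β, β')]
    simp only [mul_assoc]
    rw [← Finset.mul_sum]
    change (c : ℂ)⁻¹ * ((bondPairing D ᵥ* (E * V.normTransfer (j, i))) ⬝ᵥ
        ((V.normTransfer (l, k) * E) *ᵥ bondPairing D)) = _
    rw [h2, ← mul_assoc, inv_mul_cancel₀ hcne, one_mul]
  · intro n hn
    rw [← V.mpo_eq_alternating]
    ext j i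
    rw [V.conjTranspose_mul_self_apply]
    have := Tensor.heisenberg_diagWeight hV.traceDelta (N := 2 * n) (by omega) i j
    refine Eq.trans this ?_
    rw [Matrix.one_apply]
    simp only [eq_comm]

end Simple

end MPI

/-! ### Assembly of the main theorem -/

theorem theorem1 (din dout χ D : ℕ) (hD : 0 < D)
    (V : MPI.Tensor (Fin dout) (Fin χ) (Fin din) D) (hV : V.IsHMPI) :
    ∃ q : ℕ, 1 ≤ q ∧ q ≤ D ^ 4 ∧
      (∃ (l r : ℕ)
        (u : Matrix (Fin l × Fin r) ((Fin q → Fin din) × (Fin q → Fin din)) ℂ)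
        (v : Matrix
          (((Fin q → Fin dout) × (Fin q → Fin χ)) × ((Fin q → Fin dout) × (Fin q → Fin χ)))
          (Fin r × Fin l) ℂ),
        uᴴ * u = 1 ∧ vᴴ * v = 1 ∧
        (din ^ q) ^ 2 ≤ r * l ∧ r * l ≤ (dout ^ q) ^ 2 * (χ ^ q) ^ 2 ∧
        ∀ n : ℕ, 1 ≤ n → (V.blocked q).mpo (2 * n) = MPI.brickwall u v n) ∧
      (V.blocked q).SpreadsCorrelationsAtMost 4 ∧
      V.SpreadsCorrelationsAtMost (4 * q) := by
  -- With `din = 0` there is no vacuum input to choose. The input space is zero, there are no input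
  -- states, and empty gates with `q = 1` work.
  rcases Nat.eq_zero_or_pos din with rfl | hdin
  · have hstate : ∀ {I : Type} [Fintype I] [IsEmpty I] {N : ℕ}, 1 ≤ N →
        ∀ σ : Matrix (Fin N → I) (Fin N → I) ℂ, ¬ MPI.IsState σ := by
      intro I _ _ N hN σ hσ
      have : IsEmpty (Fin N → I) := ⟨fun i => isEmptyElim (i ⟨0, hN⟩)⟩
      have h := hσ.2
      simp [Matrix.trace] at h
    have hempty : IsEmpty (Fin 1 → Fin 0) := ⟨fun i => (i 0).elim0⟩
    refine ⟨1, le_rfl, Nat.one_le_pow _ _ hD, ⟨0, 0, 0, 0, ?_, ?_, by simp, by simp, ?_⟩, ?_, ?_⟩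
    · ext x; exact isEmptyElim x
    · ext x; exact x.1.elim0
    · intro n hn
      ext s i
      exact isEmptyElim (i ⟨0, by omega⟩)
    · intro N hN σ hσ
      exact absurd hσ (hstate hN σ)
    · intro N hN σ hσ
      exact absurd hσ (hstate hN σ)
  · have hsimple := hV.isSimple hD ⟨0, hdin⟩
    have hblocked := hsimple.blocked
    -- The blocked tensor is simple at length 1 and the original at length `D * D`, which gives the
    -- spreads `4 * 1` and `4 * (D * D)`.
    refine ⟨D * D, hsimple.pos, ?_, ?_, hblocked.spreadsCorrelationsAtMost,
      hsimple.spreadsCorrelationsAtMost⟩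
    · rw [← pow_two]; exact Nat.pow_le_pow_right hD (by norm_num)
    · obtain ⟨l, r, u, v, hu, hv, h⟩ := hblocked.exists_brickwall
      refine ⟨l, r, u, v, hu, hv, ?_, ?_, h⟩
      · have := MPI.card_le_of_conjTranspose_mul_self hu
        simp only [Fintype.card_prod, Fintype.card_fun, Fintype.card_fin] at this
        rwa [pow_two, mul_comm r]
      · have := MPI.card_le_of_conjTranspose_mul_self hv
        simp only [Fintype.card_prod, Fintype.card_fun, Fintype.card_fin] at this
        refine this.trans (le_of_eq ?_)
        ring
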